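/- **Corollary (Gradient Descent).** An operator $\mathcal{A}=(A_1,\dots,A_k)$ is a tuple of real $m\times n$ matrices. Its size is $s(\mathcal{A})=\sum_{i}\|A_i\|_F^2$ and its error matrices are $E=s(\mathcal{A})I_m-m\sum_i A_iA_i^{*}$ and $F=s(\mathcal{A})I_n-n\sum_i A_i^{*}A_i$. It is $\varepsilon$-nearly doubly balanced if $(1-\varepsilon)\frac{s(\mathcal{A})}{m}I_m\preceq\sum_i A_iA_i^{*}\preceq(1+\varepsilon)\frac{s(\mathcal{A})}{m}I_m$ and $(1-\varepsilon)\frac{s(\mathcal{A})}{n}I_n\preceq\sum_i A_i^{*}A_i\preceq(1+\varepsilon)\frac{s(\mathcal{A})}{n}I_n$. It has a $\lambda$-spectral gap if the second largest singular value of the $m^2\times n^2$ matrix $\sum_i A_i\otimes A_i$ is at most $(1-\lambda)\,s(\mathcal{A})/\sqrt{mn}$. A scaling of $\mathcal{A}$ is an operator $(LA_1R,\dots,LA_kR)$ with $L\in\mathbb{R}^{m\times m}$ and $R\in\mathbb{R}^{n\times n}$ invertible. Gradient descent with step size $\alpha$ starts from $\mathcal{A}/\sqrt{s(\mathcal{A})}$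 (so that the initial size is one) and repeats the update $$A_i\leftarrow(I_m+\alpha E)\,A_i\,(I_n+\alpha F)\qquad(1\le i\le k),$$ where $E,F$ are the error matrices of the current operator. There are absolute constants $C,c,K>0$ such that the following holds. Let $2\le m\le n$, let $\mathcal{A}=(A_1,\dots,A_k)$ be a nonzero tuple of real $m\times n$ matrices that is $\varepsilon$-nearly doubly balanced and has a $\lambda$-spectral gap, where $\lambda>0$ and $\lambda^2\ge C\varepsilon\log m$. Then for every $0<\eta\le1$, gradient descent with step size $\alpha=c\,(m+n)^{-2}$ reaches an $\eta$-nearly doubly balanced scaling of $\mathcal{A}$ within $$K\,\frac{(n+m)^2}{\lambda}\log\frac{m+n}{\eta}$$ iterations, and all later iterates are $\eta$-nearly doubly balanced scalings of $\mathcal{A}$ as well. -/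

import Mathlib

namespace OperatorScaling

open scoped Kronecker

/-- An operator: a tuple `(A₁, …, A_k)` of real `m × n` matrices. -/
abbrev Operator (k m n : ℕ) : Type := Fin k → Matrix (Fin m) (Fin n) ℝ

variable {k m n : ℕ}

/-- The size `s(𝒜) = ∑ᵢ ‖Aᵢ‖_F²`, the sum of the squares of all entries. -/
noncomputable def size (A : Operator k m n) : ℝ :=
  ∑ i, ∑ a, ∑ b, (A i a b) ^ 2

/-- The left marginal `∑ᵢ Aᵢ Aᵢ*`. -/
noncomputable def leftMarginal (A : Operator k m n) : Matrix (Fin m) (Fin m) ℝ :=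
  ∑ i, A i * (A i).transpose

/-- The right marginal `∑ᵢ Aᵢ* Aᵢ`. -/
noncomputable def rightMarginal (A : Operator k m n) : Matrix (Fin n) (Fin n) ℝ :=
  ∑ i, (A i).transpose * A i

/-- `𝒜` is `ε`-nearly doubly balanced:
`(1 - ε) (s/m) I ≼ ∑ᵢ Aᵢ Aᵢ* ≼ (1 + ε) (s/m) I` and
`(1 - ε) (s/n) I ≼ ∑ᵢ Aᵢ* Aᵢ ≼ (1 + ε) (s/n) I` in the Loewner order. -/
def IsNearlyDoublyBalanced (ε : ℝ) (A : Operator k m n) : Prop :=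
  (leftMarginal A - ((1 - ε) * (size A / m)) • (1 : Matrix (Fin m) (Fin m) ℝ)).PosSemidef ∧
  (((1 + ε) * (size A / m)) • (1 : Matrix (Fin m) (Fin m) ℝ) - leftMarginal A).PosSemidef ∧
  (rightMarginal A - ((1 - ε) * (size A / n)) • (1 : Matrix (Fin n) (Fin n) ℝ)).PosSemidef ∧
  (((1 + ε) * (size A / n)) • (1 : Matrix (Fin n) (Fin n) ℝ) - rightMarginal A).PosSemidef

/-- The `m² × n²` matrix `M_𝒜 = ∑ᵢ Aᵢ ⊗ Aᵢ`. -/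
noncomputable def naturalMatrix (A : Operator k m n) :
    Matrix (Fin m × Fin m) (Fin n × Fin n) ℝ :=
  ∑ i, A i ⊗ₖ A i

/-- `𝒜` has a `λ`-spectral gap: `σ₂(M_𝒜) ≤ (1 - λ) s(𝒜) / √(mn)`. Singular values are listed in
descending order with multiplicity and indexed from `0`, so that index `1` is the second largest. -/
def HasSpectralGap (lam : ℝ) (A : Operator k m n) : Prop :=
  (Matrix.toEuclideanLin (naturalMatrix A)).singularValues 1 ≤
    (1 - lam) * (size A / √((m : ℝ) * n))

/-- The left error matrix `E = s I - m ∑ᵢ Aᵢ Aᵢ*`. -/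
noncomputable def errorE (A : Operator k m n) : Matrix (Fin m) (Fin m) ℝ :=
  size A • (1 : Matrix (Fin m) (Fin m) ℝ) - (m : ℝ) • leftMarginal A

/-- The right error matrix `F = s I - n ∑ᵢ Aᵢ* Aᵢ`. -/
noncomputable def errorF (A : Operator k m n) : Matrix (Fin n) (Fin n) ℝ :=
  size A • (1 : Matrix (Fin n) (Fin n) ℝ) - (n : ℝ) • rightMarginal A

/-- One step of discrete gradient descent with step size `α`:
`Aᵢ ← (I + α E) Aᵢ (I + α F)`, where `E`, `F` are the error matrices of the current operator. -/
noncomputable def gradientStep (α : ℝ) (A : Operator k m n) : Operator k m n :=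
  fun i => (1 + α • errorE A) * A i * (1 + α • errorF A)

/-- The operator rescaled to size one (for nonzero size). -/
noncomputable def normalize (A : Operator k m n) : Operator k m n :=
  fun i => (√(size A))⁻¹ • A i

/-- The operator held by gradient descent with step size `α` after `t` iterations: it is started at
the input rescaled to size one. -/
noncomputable def gradientDescent (α : ℝ) (A : Operator k m n) (t : ℕ) : Operator k m n :=
  (gradientStep α)^[t] (normalize A)

/-- `B` is a scaling of `𝒜`: `Bᵢ = L Aᵢ R` for invertible scaling matrices `L`, `R`. -/
def IsScaling (A B : Operator k m n) : Prop :=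
  ∃ (L : Matrix (Fin m) (Fin m) ℝ) (R : Matrix (Fin n) (Fin n) ℝ),
    IsUnit L ∧ IsUnit R ∧ ∀ i, B i = L * A i * R

end OperatorScaling

/-!
One gradient step changes the error matrices by `E ↦ (1 - 2αs) E - 2α m ∑ᵢ Aᵢ F Aᵢ*`, and
symmetrically for `F`, up to a remainder of second order in the errors. Since `E` and `F` are
traceless, the spectral gap damps the cross term, and the Frobenius norms `‖E‖_F / √m` and
`‖F‖_F / √n` decay geometrically at rate `1 - αλ/4`, as long as the size stays close to `1` and the
gap close to its initial value. Both drift by a multiple of `α ∑ₜ max(‖Eₜ‖, ‖Fₜ‖)`, so the point is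
to bound this sum by `O(λ)`.

In operator norm the larger error is not contracted, but it drops by about
`2α (max(‖E‖, ‖F‖) - min(‖E‖, ‖F‖))` in each step. Telescoping bounds the sum of the maxima by that
of the minima. The smaller operator norm is at most `√min(m, n)` times the decaying Frobenius
quantity and at most `2ε`, so only the first `O(log min(m, n) / (αλ))` steps matter, and the sum is
`O(ε log min(m, n) / λ)`, which the hypothesis makes `O(λ)`.

Initially, the gap on traceless matrices comes from Ky Fan's inequality: on the identity and a
traceless matrix together, `∑ᵢ Aᵢ ⊗ Aᵢ` has at most the energy `σ₁² + σ₂²`, and the identity already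
takes up almost all of `σ₁²`.
-/

namespace OperatorScaling

open scoped Matrix Matrix.Norms.L2Operator

section Frobenius

variable {ι κ τ : Type*} [Fintype ι] [Fintype κ] [Fintype τ]

/-- The Frobenius norm of a rectangular real matrix, as the Euclidean norm of its vectorization.
Mathlib's Frobenius instance would clash with the operator norm `‖X‖` used alongside it. -/
noncomputable def frob : Seminorm ℝ (Matrix ι κ ℝ) :=
  Seminorm.of (fun X => ‖WithLp.toLp 2 X.vec‖)
    (fun X Y => by simpa only [Matrix.vec_add, WithLp.toLp_add] using norm_add_le _ _)
    (fun c X => by rw [Matrix.vec_smul, WithLp.toLp_smul, norm_smul])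

theorem frob_eq_norm_vec (X : Matrix ι κ ℝ) : frob X = ‖WithLp.toLp 2 X.vec‖ := rfl

theorem frob_nonneg (X : Matrix ι κ ℝ) : 0 ≤ frob X := apply_nonneg frob X

theorem frob_smul (c : ℝ) (X : Matrix ι κ ℝ) : frob (c • X) = |c| * frob X :=
  map_smul_eq_mul frob c X

theorem frob_sq (X : Matrix ι κ ℝ) : frob X ^ 2 = ∑ a, ∑ b, X a b ^ 2 := by
  rw [frob_eq_norm_vec, EuclideanSpace.real_norm_sq_eq, Fintype.sum_prod_type, Finset.sum_comm]
  rfl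

theorem frob_transpose (X : Matrix ι κ ℝ) : frob Xᵀ = frob X := by
  rw [← sq_eq_sq₀ (frob_nonneg _) (frob_nonneg _), frob_sq, frob_sq, Finset.sum_comm]
  rfl

theorem inner_vec (X Y : Matrix ι κ ℝ) :
    inner ℝ (WithLp.toLp 2 X.vec) (WithLp.toLp 2 Y.vec) = (Xᵀ * Y).trace := by
  rw [EuclideanSpace.inner_toLp_toLp, star_trivial, dotProduct_comm, Matrix.vec_dotProduct_vec]

theorem trace_transpose_mul_self (X : Matrix ι κ ℝ) : (Xᵀ * X).trace = frob X ^ 2 := by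
  rw [← inner_vec, real_inner_self_eq_norm_sq, frob_eq_norm_vec]

theorem abs_trace_transpose_mul_le (X Y : Matrix ι κ ℝ) :
    |(Xᵀ * Y).trace| ≤ frob X * frob Y := by
  rw [← inner_vec]
  exact abs_real_inner_le_norm _ _

theorem trace_transpose_mul_comm (X Y : Matrix ι κ ℝ) : (Xᵀ * Y).trace = (Yᵀ * X).trace := by
  rw [← inner_vec, real_inner_comm, inner_vec]

theorem frob_one [DecidableEq ι] : frob (1 : Matrix ι ι ℝ) = √(Fintype.card ι) := by
  rw [← Real.sqrt_sq (frob_nonneg _), ← trace_transpose_mul_self]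
  simp

theorem l2_opNorm_transpose [DecidableEq ι] [DecidableEq κ] (X : Matrix ι κ ℝ) : ‖Xᵀ‖ = ‖X‖ := by
  rw [← Matrix.conjTranspose_eq_transpose_of_trivial, Matrix.l2_opNorm_conjTranspose]

theorem frob_mul_le_l2_opNorm_mul [DecidableEq κ] (X : Matrix ι κ ℝ) (Y : Matrix κ τ ℝ) :
    frob (X * Y) ≤ ‖X‖ * frob Y := by
  have column_le (b : τ) : ∑ a, (X * Y) a b ^ 2 ≤ ‖X‖ ^ 2 * ∑ j, Y j b ^ 2 := by
    have h := pow_le_pow_left₀ (norm_nonneg _)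
      (Matrix.l2_opNorm_mulVec X (WithLp.toLp 2 fun j => Y j b)) 2
    rwa [mul_pow, EuclideanSpace.real_norm_sq_eq, EuclideanSpace.real_norm_sq_eq] at h
  rw [← sq_le_sq₀ (frob_nonneg _) (mul_nonneg (norm_nonneg _) (frob_nonneg _)), mul_pow, frob_sq,
    frob_sq, Finset.sum_comm, Finset.sum_comm (f := fun a b => Y a b ^ 2), Finset.mul_sum]
  exact Finset.sum_le_sum fun b _ => column_le b

theorem frob_mul_le_mul_l2_opNorm [DecidableEq τ] (X : Matrix ι κ ℝ)
    (Y : Matrix κ τ ℝ) : frob (X * Y) ≤ frob X * ‖Y‖ := by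
  classical
  rw [← frob_transpose, Matrix.transpose_mul, mul_comm, ← l2_opNorm_transpose Y,
    ← frob_transpose X]
  exact frob_mul_le_l2_opNorm_mul _ _

theorem l2_opNorm_le_frob [DecidableEq κ] (X : Matrix ι κ ℝ) : ‖X‖ ≤ frob X := by
  rw [Matrix.l2_opNorm_def]
  refine ContinuousLinearMap.opNorm_le_bound _ (frob_nonneg X) fun v => ?_
  rw [← sq_le_sq₀ (norm_nonneg _) (mul_nonneg (frob_nonneg X) (norm_nonneg v)), mul_pow, frob_sq,
    EuclideanSpace.real_norm_sq_eq, EuclideanSpace.real_norm_sq_eq, Finset.sum_mul]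
  exact Finset.sum_le_sum fun a _ => Finset.sum_mul_sq_le_sq_mul_sq Finset.univ (X a) v

theorem frob_le_sqrt_card_mul_l2_opNorm [DecidableEq ι] (X : Matrix ι ι ℝ) :
    frob X ≤ √(Fintype.card ι) * ‖X‖ := by
  simpa [frob_one] using frob_mul_le_mul_l2_opNorm (1 : Matrix ι ι ℝ) X

theorem abs_trace_le [DecidableEq ι] (X : Matrix ι ι ℝ) : |X.trace| ≤ Fintype.card ι * ‖X‖ := by
  calc |X.trace| ≤ √(Fintype.card ι) * frob X := by
        simpa [frob_one] using abs_trace_transpose_mul_le (1 : Matrix ι ι ℝ) X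
    _ ≤ √(Fintype.card ι) * (√(Fintype.card ι) * ‖X‖) := by
        gcongr
        exact frob_le_sqrt_card_mul_l2_opNorm X
    _ = Fintype.card ι * ‖X‖ := by rw [← mul_assoc, Real.mul_self_sqrt (Nat.cast_nonneg _)]

theorem l2_opNorm_one_le [DecidableEq ι] : ‖(1 : Matrix ι ι ℝ)‖ ≤ 1 := by
  cases isEmpty_or_nonempty ι
  · simp [Subsingleton.elim (1 : Matrix ι ι ℝ) 0]
  · exact CStarRing.norm_one.le

open scoped MatrixOrder in
theorem l2_opNorm_le_iff_posSemidef [DecidableEq ι] {X : Matrix ι ι ℝ} (hX : X.IsHermitian)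
    {c : ℝ} (hc : 0 ≤ c) :
    ‖X‖ ≤ c ↔
      (c • (1 : Matrix ι ι ℝ) - X).PosSemidef ∧ (c • (1 : Matrix ι ι ℝ) + X).PosSemidef := by
  have hsa : IsSelfAdjoint X := hX
  have spectrum_bound : ‖X‖ ≤ c ↔ ∀ x ∈ spectrum ℝ X, |x| ≤ c := by
    simpa only [cfc_id' ℝ X, Real.norm_eq_abs] using norm_cfc_le_iff (fun x : ℝ => x) X hc
  have upper : (c • (1 : Matrix ι ι ℝ) - X).PosSemidef ↔ ∀ x ∈ spectrum ℝ X, x ≤ c := by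
    rw [← Matrix.le_iff, ← Algebra.algebraMap_eq_smul_one, le_algebraMap_iff_spectrum_le]
  have lower : (c • (1 : Matrix ι ι ℝ) + X).PosSemidef ↔ ∀ x ∈ spectrum ℝ X, -c ≤ x := by
    rw [add_comm, ← sub_neg_eq_add, ← neg_smul, ← Matrix.le_iff, ← Algebra.algebraMap_eq_smul_one,
      algebraMap_le_iff_le_spectrum]
  simp only [spectrum_bound, upper, lower, abs_le, forall₂_and, and_comm]

end Frobenius

section KrausMap

variable {k m n : ℕ}

/-- The completely positive map `Y ↦ ∑ᵢ Aᵢ Y Aᵢ*`, whose matrix in vectorized form is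
`naturalMatrix A`. -/
noncomputable def krausMap (A : Operator k m n) :
    Matrix (Fin n) (Fin n) ℝ →ₗ[ℝ] Matrix (Fin m) (Fin m) ℝ where
  toFun Y := ∑ i, A i * Y * (A i)ᵀ
  map_add' X Y := by simp only [Matrix.mul_add, Matrix.add_mul, Finset.sum_add_distrib]
  map_smul' c Y := by simp [Finset.smul_sum]

/-- The tuple `(A₁*, …, A_k*)`; it exchanges the roles of left and right. -/
def flip (A : Operator k m n) : Operator k n m := fun i => (A i)ᵀ

theorem krausMap_apply (A : Operator k m n) (Y : Matrix (Fin n) (Fin n) ℝ) :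
    krausMap A Y = ∑ i, A i * Y * (A i)ᵀ := rfl

theorem krausMap_one (A : Operator k m n) : krausMap A 1 = leftMarginal A := by
  simp [krausMap_apply, leftMarginal]

theorem leftMarginal_flip (A : Operator k m n) : leftMarginal (flip A) = rightMarginal A := rfl

theorem size_nonneg (A : Operator k m n) : 0 ≤ size A := by
  unfold size
  positivity

theorem size_flip (A : Operator k m n) : size (flip A) = size A :=
  Finset.sum_congr rfl fun _ _ => Finset.sum_comm

theorem errorE_flip (A : Operator k m n) : errorE (flip A) = errorF A := by
  rw [errorE, errorF, size_flip, leftMarginal_flip]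

theorem errorF_flip (A : Operator k m n) : errorF (flip A) = errorE A :=
  (errorE_flip (flip A)).symm

theorem leftMarginal_transpose (A : Operator k m n) : (leftMarginal A)ᵀ = leftMarginal A := by
  simp [leftMarginal, Matrix.transpose_sum]

theorem errorE_transpose (A : Operator k m n) : (errorE A)ᵀ = errorE A := by
  simp [errorE, leftMarginal_transpose]

theorem errorF_transpose (A : Operator k m n) : (errorF A)ᵀ = errorF A :=
  errorE_flip A ▸ errorE_transpose (flip A)

theorem smul_leftMarginal (A : Operator k m n) :
    (m : ℝ) • leftMarginal A = size A • 1 - errorE A := by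
  simp [errorE]

theorem trace_leftMarginal (A : Operator k m n) : (leftMarginal A).trace = size A := by
  rw [leftMarginal, Matrix.trace_sum, size]
  refine Finset.sum_congr rfl fun i _ => ?_
  simp [Matrix.trace, Matrix.mul_apply, sq]

theorem trace_errorE (A : Operator k m n) : (errorE A).trace = 0 := by
  simp [errorE, trace_leftMarginal, mul_comm]

theorem trace_errorF (A : Operator k m n) : (errorF A).trace = 0 :=
  errorE_flip A ▸ trace_errorE (flip A)

theorem trace_krausMap (A : Operator k m n) (Y : Matrix (Fin n) (Fin n) ℝ) :
    (krausMap A Y).trace = (rightMarginal A * Y).trace := by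
  simp only [krausMap_apply, rightMarginal, Matrix.trace_sum, Matrix.sum_mul]
  refine Finset.sum_congr rfl fun i _ => ?_
  rw [Matrix.trace_mul_comm, ← Matrix.mul_assoc]

theorem trace_transpose_mul_krausMap_flip (A : Operator k m n) (X : Matrix (Fin m) (Fin m) ℝ)
    (Y : Matrix (Fin n) (Fin n) ℝ) :
    (Yᵀ * krausMap (flip A) X).trace = (Xᵀ * krausMap A Y).trace := by
  rw [trace_transpose_mul_comm X]
  simp only [krausMap_apply, flip, Matrix.mul_sum, Matrix.transpose_sum, Matrix.sum_mul,
    Matrix.trace_sum]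
  refine Finset.sum_congr rfl fun i _ => ?_
  simp only [Matrix.transpose_mul, Matrix.transpose_transpose]
  rw [← Matrix.mul_assoc, Matrix.trace_mul_comm]
  simp only [Matrix.mul_assoc]

theorem trace_transpose_mul_krausMap (A : Operator k m n) (X : Matrix (Fin m) (Fin m) ℝ)
    (Y : Matrix (Fin n) (Fin n) ℝ) :
    (Xᵀ * krausMap A Y).trace = ∑ i, ((X * A i)ᵀ * (A i * Y)).trace := by
  simp only [krausMap_apply, Matrix.mul_sum, Matrix.trace_sum]
  refine Finset.sum_congr rfl fun i _ => ?_
  rw [Matrix.transpose_mul, ← Matrix.mul_assoc, Matrix.trace_mul_comm]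
  simp only [Matrix.mul_assoc]

theorem sum_frob_mul_sq_le (A : Operator k m n) (X : Matrix (Fin m) (Fin m) ℝ) :
    ∑ i, frob (X * A i) ^ 2 ≤ ‖leftMarginal A‖ * frob X ^ 2 := by
  calc ∑ i, frob (X * A i) ^ 2 = (Xᵀ * (X * leftMarginal A)).trace := by
        simp only [← trace_transpose_mul_self, leftMarginal, Matrix.mul_sum, Matrix.trace_sum]
        refine Finset.sum_congr rfl fun i _ => ?_
        rw [Matrix.transpose_mul, Matrix.mul_assoc, Matrix.trace_mul_comm]
        simp only [Matrix.mul_assoc]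
    _ ≤ frob X * frob (X * leftMarginal A) :=
        (le_abs_self _).trans (abs_trace_transpose_mul_le _ _)
    _ ≤ frob X * (frob X * ‖leftMarginal A‖) :=
        mul_le_mul_of_nonneg_left (frob_mul_le_mul_l2_opNorm _ _) (frob_nonneg X)
    _ = ‖leftMarginal A‖ * frob X ^ 2 := by ring

theorem sum_mul_frob_sq_le (A : Operator k m n) (Y : Matrix (Fin n) (Fin n) ℝ) :
    ∑ i, frob (A i * Y) ^ 2 ≤ ‖rightMarginal A‖ * frob Y ^ 2 := by
  simpa only [leftMarginal_flip, flip, ← Matrix.transpose_mul, frob_transpose] using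
    sum_frob_mul_sq_le (flip A) Yᵀ

theorem abs_trace_transpose_mul_krausMap_le (A : Operator k m n) (X : Matrix (Fin m) (Fin m) ℝ)
    (Y : Matrix (Fin n) (Fin n) ℝ) :
    |(Xᵀ * krausMap A Y).trace| ≤
      √‖leftMarginal A‖ * √‖rightMarginal A‖ * (frob X * frob Y) := by
  rw [trace_transpose_mul_krausMap]
  calc |∑ i, ((X * A i)ᵀ * (A i * Y)).trace| ≤ ∑ i, frob (X * A i) * frob (A i * Y) :=
        (Finset.abs_sum_le_sum_abs _ _).trans
          (Finset.sum_le_sum fun i _ => abs_trace_transpose_mul_le _ _)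
    _ ≤ √(∑ i, frob (X * A i) ^ 2) * √(∑ i, frob (A i * Y) ^ 2) :=
        Real.sum_mul_le_sqrt_mul_sqrt _ _ _
    _ ≤ √(‖leftMarginal A‖ * frob X ^ 2) * √(‖rightMarginal A‖ * frob Y ^ 2) := by
        gcongr
        · exact sum_frob_mul_sq_le A X
        · exact sum_mul_frob_sq_le A Y
    _ = √‖leftMarginal A‖ * √‖rightMarginal A‖ * (frob X * frob Y) := by
        rw [Real.sqrt_mul (norm_nonneg _), Real.sqrt_mul (norm_nonneg _),
          Real.sqrt_sq (frob_nonneg _), Real.sqrt_sq (frob_nonneg _)]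
        ring

theorem frob_krausMap_le (A : Operator k m n) (Y : Matrix (Fin n) (Fin n) ℝ) :
    frob (krausMap A Y) ≤ √‖leftMarginal A‖ * √‖rightMarginal A‖ * frob Y := by
  have h := (le_abs_self _).trans (abs_trace_transpose_mul_krausMap_le A (krausMap A Y) Y)
  rw [trace_transpose_mul_self] at h
  rcases (frob_nonneg (krausMap A Y)).eq_or_lt with h0 | h0
  · rw [← h0]
    exact mul_nonneg (by positivity) (frob_nonneg Y)
  · exact le_of_mul_le_mul_left (by linarith) h0

theorem posSemidef_krausMap (A : Operator k m n) {Y : Matrix (Fin n) (Fin n) ℝ}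
    (hY : Y.PosSemidef) : (krausMap A Y).PosSemidef := by
  rw [krausMap_apply]
  exact Matrix.posSemidef_sum _ fun i _ => hY.mul_mul_conjTranspose_same (A i)

theorem isHermitian_krausMap (A : Operator k m n) {Y : Matrix (Fin n) (Fin n) ℝ}
    (hY : Y.IsHermitian) : (krausMap A Y).IsHermitian := by
  have hYt : Yᵀ = Y := hY
  rw [Matrix.IsHermitian, Matrix.conjTranspose_eq_transpose_of_trivial]
  simp only [krausMap_apply, Matrix.transpose_sum, Matrix.transpose_mul, Matrix.transpose_transpose,
    hYt, Matrix.mul_assoc]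

theorem l2_opNorm_krausMap_le (A : Operator k m n) {Y : Matrix (Fin n) (Fin n) ℝ}
    (hY : Y.IsHermitian) : ‖krausMap A Y‖ ≤ ‖Y‖ * ‖leftMarginal A‖ := by
  obtain ⟨hYsub, hYadd⟩ := (l2_opNorm_le_iff_posSemidef hY (norm_nonneg Y)).1 le_rfl
  have hP := (l2_opNorm_le_iff_posSemidef (X := leftMarginal A) (leftMarginal_transpose A)
    (norm_nonneg _)).1 le_rfl
  rw [l2_opNorm_le_iff_posSemidef (isHermitian_krausMap A hY) (by positivity)]
  have hP' := hP.1.smul (norm_nonneg Y)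
  constructor
  · convert hP'.add (posSemidef_krausMap A hYsub) using 1
    rw [map_sub, map_smul, krausMap_one]
    module
  · convert hP'.add (posSemidef_krausMap A hYadd) using 1
    rw [map_add, map_smul, krausMap_one]
    module

end KrausMap

section ErrorNorms

variable {k m n : ℕ}

/-- The larger of the operator norms of the two error matrices. -/
noncomputable def maxError (A : Operator k m n) : ℝ := max ‖errorE A‖ ‖errorF A‖

/-- The smaller of the operator norms of the two error matrices. -/
noncomputable def minError (A : Operator k m n) : ℝ := min ‖errorE A‖ ‖errorF A‖

/-- The larger of the dimension-normalized Frobenius norms of the two error matrices. -/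
noncomputable def rmsError (A : Operator k m n) : ℝ :=
  max (frob (errorE A) / √m) (frob (errorF A) / √n)

theorem norm_errorE_le (A : Operator k m n) : ‖errorE A‖ ≤ maxError A := le_max_left _ _

theorem norm_errorF_le (A : Operator k m n) : ‖errorF A‖ ≤ maxError A := le_max_right _ _

theorem maxError_nonneg (A : Operator k m n) : 0 ≤ maxError A :=
  (norm_nonneg _).trans (norm_errorE_le A)

theorem rmsError_nonneg (A : Operator k m n) : 0 ≤ rmsError A :=
  le_max_of_le_left (div_nonneg (frob_nonneg _) (Real.sqrt_nonneg _))

theorem minError_le_maxError (A : Operator k m n) : minError A ≤ maxError A := min_le_max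

theorem maxError_flip (A : Operator k m n) : maxError (flip A) = maxError A := by
  rw [maxError, maxError, errorE_flip, errorF_flip, max_comm]

theorem rmsError_flip (A : Operator k m n) : rmsError (flip A) = rmsError A := by
  rw [rmsError, rmsError, errorE_flip, errorF_flip, max_comm]

theorem frob_errorE_le (A : Operator k m n) : frob (errorE A) ≤ √m * rmsError A := by
  obtain rfl | hm := m.eq_zero_or_pos
  · simp [Subsingleton.elim (errorE A) 0]
  · rw [← div_le_iff₀' (by positivity)]
    exact le_max_left _ _

theorem frob_errorF_le (A : Operator k m n) : frob (errorF A) ≤ √n * rmsError A :=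
  errorE_flip A ▸ rmsError_flip A ▸ frob_errorE_le (flip A)

theorem rmsError_le_maxError (A : Operator k m n) : rmsError A ≤ maxError A := by
  have normalized_le {d : ℕ} (X : Matrix (Fin d) (Fin d) ℝ) : frob X / √d ≤ ‖X‖ :=
    div_le_of_le_mul₀ (Real.sqrt_nonneg _) (norm_nonneg _) <| by
      simpa [mul_comm] using frob_le_sqrt_card_mul_l2_opNorm X
  exact max_le_max (normalized_le _) (normalized_le _)

theorem minError_le_sqrt_min_mul_rmsError (A : Operator k m n) :
    minError A ≤ √(min m n : ℕ) * rmsError A := by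
  rcases min_cases m n with ⟨h, -⟩ | ⟨h, -⟩ <;> rw [h]
  · exact (min_le_left _ _).trans ((l2_opNorm_le_frob _).trans (frob_errorE_le A))
  · exact (min_le_right _ _).trans ((l2_opNorm_le_frob _).trans (frob_errorF_le A))

theorem maxError_le_add_mul_rmsError (A : Operator k m n) :
    maxError A ≤ (m + n) * rmsError A := by
  have hr := rmsError_nonneg A
  have sqrt_le (d : ℕ) : √(d : ℝ) ≤ d :=
    Real.sqrt_le_iff.2 ⟨Nat.cast_nonneg d, by exact_mod_cast Nat.le_self_pow two_ne_zero d⟩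
  refine max_le ((l2_opNorm_le_frob _).trans ((frob_errorE_le A).trans ?_))
    ((l2_opNorm_le_frob _).trans ((frob_errorF_le A).trans ?_)) <;> gcongr
  · exact (sqrt_le m).trans (le_add_of_nonneg_right (Nat.cast_nonneg n))
  · exact (sqrt_le n).trans (le_add_of_nonneg_left (Nat.cast_nonneg m))

theorem natCast_mul_norm_leftMarginal_le (A : Operator k m n) :
    m * ‖leftMarginal A‖ ≤ size A + maxError A := by
  calc m * ‖leftMarginal A‖ = ‖size A • (1 : Matrix (Fin m) (Fin m) ℝ) - errorE A‖ := by
        rw [← smul_leftMarginal, norm_smul, Real.norm_natCast]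
    _ ≤ size A * 1 + maxError A := by
        refine (norm_sub_le _ _).trans (add_le_add ?_ (norm_errorE_le A))
        rw [norm_smul, Real.norm_of_nonneg (size_nonneg A)]
        exact mul_le_mul_of_nonneg_left l2_opNorm_one_le (size_nonneg A)
    _ = size A + maxError A := by rw [mul_one]

theorem norm_smul_krausMap_le (A : Operator k m n) {Y : Matrix (Fin n) (Fin n) ℝ}
    (hY : Y.IsHermitian) : ‖(m : ℝ) • krausMap A Y‖ ≤ ‖Y‖ * (size A + maxError A) := by
  calc ‖(m : ℝ) • krausMap A Y‖ ≤ m * (‖Y‖ * ‖leftMarginal A‖) := by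
        rw [norm_smul, Real.norm_natCast]
        exact mul_le_mul_of_nonneg_left (l2_opNorm_krausMap_le A hY) (Nat.cast_nonneg m)
    _ = ‖Y‖ * (m * ‖leftMarginal A‖) := by ring
    _ ≤ ‖Y‖ * (size A + maxError A) := by
        gcongr
        exact natCast_mul_norm_leftMarginal_le A

theorem sqrt_norm_marginals_le (A : Operator k m n) (hm : 0 < m) (hn : 0 < n) :
    √‖leftMarginal A‖ * √‖rightMarginal A‖ ≤ (size A + maxError A) / (√m * √n) := by
  have hP := natCast_mul_norm_leftMarginal_le A
  have hQ := natCast_mul_norm_leftMarginal_le (flip A)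
  rw [leftMarginal_flip, size_flip, maxError_flip] at hQ
  have hS := add_nonneg (size_nonneg A) (maxError_nonneg A)
  rw [le_div_iff₀ (by positivity)]
  calc √‖leftMarginal A‖ * √‖rightMarginal A‖ * (√m * √n)
      = √(m * ‖leftMarginal A‖) * √(n * ‖rightMarginal A‖) := by
        rw [Real.sqrt_mul (Nat.cast_nonneg _), Real.sqrt_mul (Nat.cast_nonneg _)]
        ring
    _ ≤ √(size A + maxError A) * √(size A + maxError A) := by gcongr
    _ = size A + maxError A := Real.mul_self_sqrt hS

end ErrorNorms

section GradientStep

variable {k m n : ℕ}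

theorem gradientStep_flip (α : ℝ) (A : Operator k m n) :
    gradientStep α (flip A) = flip (gradientStep α A) := by
  funext i
  simp [gradientStep, flip, ← errorE_flip A, ← errorF_flip A, errorE_transpose, errorF_transpose,
    Matrix.mul_assoc]

theorem krausMap_gradientStep (α : ℝ) (A : Operator k m n) (Y : Matrix (Fin n) (Fin n) ℝ) :
    krausMap (gradientStep α A) Y =
      (1 + α • errorE A) * krausMap A ((1 + α • errorF A) * Y * (1 + α • errorF A)) *
        (1 + α • errorE A) := by
  simp only [krausMap_apply, Matrix.mul_sum, Matrix.sum_mul]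
  refine Finset.sum_congr rfl fun i _ => ?_
  simp only [gradientStep, Matrix.transpose_mul, Matrix.transpose_add, Matrix.transpose_one,
    Matrix.transpose_smul, errorE_transpose, errorF_transpose, Matrix.mul_assoc]

/-- The deviation of `s I - m ∑ᵢ Bᵢ Bᵢ*`, where `B` is the gradient step of `A` and `s` is still the
size of `A`, from its first-order Taylor polynomial in the error matrices of `A`. -/
noncomputable def stepRemainder (α : ℝ) (A : Operator k m n) : Matrix (Fin m) (Fin m) ℝ :=
  size A • (1 : Matrix (Fin m) (Fin m) ℝ) - (m : ℝ) • leftMarginal (gradientStep α A) -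
    ((1 - 2 * α * size A) • errorE A - (2 * α) • ((m : ℝ) • krausMap A (errorF A)))

theorem errorE_gradientStep (α : ℝ) (A : Operator k m n) :
    errorE (gradientStep α A) = (size (gradientStep α A) - size A) • 1 +
      ((1 - 2 * α * size A) • errorE A - (2 * α) • ((m : ℝ) • krausMap A (errorF A)) +
        stepRemainder α A) := by
  rw [stepRemainder, errorE]
  module

/-- The deviation of `m ∑ᵢ Bᵢ Bᵢ*` from `s I`, where `Bᵢ = Aᵢ (I + α F)` is the right half of a
gradient step. -/
noncomputable def halfStepError (α : ℝ) (A : Operator k m n) : Matrix (Fin m) (Fin m) ℝ :=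
  (2 * α) • ((m : ℝ) • krausMap A (errorF A)) +
    α ^ 2 • ((m : ℝ) • krausMap A (errorF A * errorF A)) - errorE A

theorem smul_leftMarginal_gradientStep (α : ℝ) (A : Operator k m n) :
    (m : ℝ) • leftMarginal (gradientStep α A) =
      (1 + α • errorE A) * (size A • 1 + halfStepError α A) * (1 + α • errorE A) := by
  have half_step : (1 + α • errorF A) * 1 * (1 + α • errorF A) =
      1 + (2 * α) • errorF A + α ^ 2 • (errorF A * errorF A) := by
    simp only [mul_one, mul_add, add_mul, one_mul, smul_mul_assoc, mul_smul_comm]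
    module
  rw [← krausMap_one, krausMap_gradientStep, half_step, ← Matrix.smul_mul, ← Matrix.mul_smul]
  congr 2
  rw [map_add, map_add, map_smul, map_smul, krausMap_one, smul_add, smul_add, smul_leftMarginal,
    halfStepError]
  module

theorem stepRemainder_eq (α : ℝ) (A : Operator k m n) :
    stepRemainder α A = -(α ^ 2 • ((m : ℝ) • krausMap A (errorF A * errorF A)) +
      α • (errorE A * halfStepError α A + halfStepError α A * errorE A) +
      α ^ 2 • (size A • (errorE A * errorE A) + errorE A * halfStepError α A * errorE A)) := by
  rw [stepRemainder, smul_leftMarginal_gradientStep]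
  have hZ : α ^ 2 • ((m : ℝ) • krausMap A (errorF A * errorF A)) =
      halfStepError α A + errorE A - (2 * α) • ((m : ℝ) • krausMap A (errorF A)) := by
    rw [halfStepError]
    module
  rw [hZ]
  simp only [mul_one, mul_add, add_mul, one_mul, smul_mul_assoc, mul_smul_comm, smul_add]
  module

/-- The regime in which one gradient step is analysed. -/
structure IsControlled (α : ℝ) (A : Operator k m n) : Prop where
  step_nonneg : 0 ≤ α
  step_le : α ≤ 1 / 8
  left_pos : 0 < m
  right_pos : 0 < n
  le_size : 3 / 4 ≤ size A
  size_le : size A ≤ 5 / 4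
  maxError_le : maxError A ≤ 1 / 4

namespace IsControlled

variable {α κ : ℝ} {A : Operator k m n}

theorem flip (h : IsControlled α A) : IsControlled α (flip A) where
  step_nonneg := h.step_nonneg
  step_le := h.step_le
  left_pos := h.right_pos
  right_pos := h.left_pos
  le_size := by rw [size_flip]; exact h.le_size
  size_le := by rw [size_flip]; exact h.size_le
  maxError_le := by rw [maxError_flip]; exact h.maxError_le

theorem two_mul_step_mul_size_nonneg (h : IsControlled α A) : 0 ≤ 2 * α * size A :=
  mul_nonneg (mul_nonneg zero_le_two h.step_nonneg) (size_nonneg A)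

theorem two_mul_step_mul_size_le (h : IsControlled α A) : 2 * α * size A ≤ 1 / 2 := by
  nlinarith [h.step_nonneg, h.step_le, h.size_le]

theorem sqrt_norm_marginals_le (h : IsControlled α A) :
    √‖leftMarginal A‖ * √‖rightMarginal A‖ ≤ 2 / (√m * √n) :=
  (OperatorScaling.sqrt_norm_marginals_le A h.left_pos h.right_pos).trans <| by
    gcongr
    linarith [h.size_le, h.maxError_le]

theorem norm_smul_krausMap_le (h : IsControlled α A) {Y : Matrix (Fin n) (Fin n) ℝ}
    (hY : Y.IsHermitian) : ‖(m : ℝ) • krausMap A Y‖ ≤ 2 * ‖Y‖ :=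
  (OperatorScaling.norm_smul_krausMap_le A hY).trans <| by
    nlinarith [h.size_le, h.maxError_le, norm_nonneg Y]

theorem frob_smul_krausMap_le (h : IsControlled α A) (Y : Matrix (Fin n) (Fin n) ℝ) :
    frob ((m : ℝ) • krausMap A Y) ≤ 2 * (√m * (frob Y / √n)) := by
  have hm : 0 < √(m : ℝ) := Real.sqrt_pos.2 (Nat.cast_pos.2 h.left_pos)
  rw [frob_smul, abs_of_nonneg (Nat.cast_nonneg m)]
  calc (m : ℝ) * frob (krausMap A Y) ≤ m * (2 / (√m * √n) * frob Y) := by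
        gcongr
        exact (frob_krausMap_le A Y).trans
          (mul_le_mul_of_nonneg_right h.sqrt_norm_marginals_le (frob_nonneg Y))
    _ = 2 * (√m * (frob Y / √n)) := by
        nth_rewrite 1 [← Real.mul_self_sqrt (Nat.cast_nonneg m : (0 : ℝ) ≤ m)]
        field_simp

theorem halfStepError_le (h : IsControlled α A) (ν : Seminorm ℝ (Matrix (Fin m) (Fin m) ℝ)) {φ : ℝ}
    (hE : ν (errorE A) ≤ φ) (hU : ν ((m : ℝ) • krausMap A (errorF A)) ≤ 2 * φ)
    (hV : ν ((m : ℝ) • krausMap A (errorF A * errorF A)) ≤ 2 * (maxError A * φ)) :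
    ν (halfStepError α A) ≤ 2 * φ := by
  obtain ⟨hα, hα8⟩ := And.intro h.step_nonneg h.step_le
  have hφ : 0 ≤ φ := (apply_nonneg ν _).trans hE
  have hV' : 2 * (maxError A * φ) ≤ 1 / 2 * φ := by nlinarith [h.maxError_le]
  have hα2 : α ^ 2 ≤ 1 / 8 := by nlinarith
  calc ν (halfStepError α A)
      ≤ 2 * α * ν ((m : ℝ) • krausMap A (errorF A)) +
        α ^ 2 * ν ((m : ℝ) • krausMap A (errorF A * errorF A)) + ν (errorE A) := by
        refine (map_sub_le_add ν _ _).trans (add_le_add_left ((map_add_le_add ν _ _).trans ?_) _)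
        rw [map_smul_eq_mul ν (2 * α), map_smul_eq_mul ν (α ^ 2),
          Real.norm_of_nonneg (by positivity), Real.norm_of_nonneg (by positivity)]
    _ ≤ 2 * (1 / 8) * (2 * φ) + 1 / 8 * (1 / 2 * φ) + φ := by
        gcongr
        exact hV.trans hV'
    _ ≤ 2 * φ := by linarith

theorem stepRemainder_le (h : IsControlled α A) (ν : Seminorm ℝ (Matrix (Fin m) (Fin m) ℝ))
    (hl : ∀ X Y, ν (X * Y) ≤ ‖X‖ * ν Y) (hr : ∀ X Y, ν (X * Y) ≤ ν X * ‖Y‖) {φ : ℝ}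
    (hE : ν (errorE A) ≤ φ) (hU : ν ((m : ℝ) • krausMap A (errorF A)) ≤ 2 * φ)
    (hV : ν ((m : ℝ) • krausMap A (errorF A * errorF A)) ≤ 2 * (maxError A * φ)) :
    ν (stepRemainder α A) ≤ 5 * (α * (maxError A * φ)) := by
  obtain ⟨hα, hα8⟩ := And.intro h.step_nonneg h.step_le
  set g := maxError A
  have hg0 : 0 ≤ g := maxError_nonneg A
  have hφ : 0 ≤ φ := (apply_nonneg ν _).trans hE
  have left_le {X : Matrix (Fin m) (Fin m) ℝ} {x : ℝ} (hX : ν X ≤ x) :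
      ν (errorE A * X) ≤ g * x :=
    (hl _ _).trans (mul_le_mul (norm_errorE_le A) hX (apply_nonneg ν X) hg0)
  have right_le {X : Matrix (Fin m) (Fin m) ℝ} {x : ℝ} (hX : ν X ≤ x) :
      ν (X * errorE A) ≤ x * g :=
    (hr _ _).trans
      (mul_le_mul hX (norm_errorE_le A) (norm_nonneg _) ((apply_nonneg ν X).trans hX))
  have hZ := h.halfStepError_le ν hE hU hV
  have second : ν (errorE A * halfStepError α A + halfStepError α A * errorE A) ≤
      g * (2 * φ) + 2 * φ * g :=
    (map_add_le_add ν _ _).trans (add_le_add (left_le hZ) (right_le hZ))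
  have third : ν (size A • (errorE A * errorE A) + errorE A * halfStepError α A * errorE A) ≤
      5 / 4 * (g * φ) + g * (2 * φ) * g := by
    refine (map_add_le_add ν _ _).trans (add_le_add ?_ (right_le (left_le hZ)))
    rw [map_smul_eq_mul, Real.norm_of_nonneg (size_nonneg A)]
    exact mul_le_mul h.size_le (left_le hE) (apply_nonneg ν _) (by norm_num)
  calc ν (stepRemainder α A)
      ≤ α ^ 2 * (2 * (g * φ)) + α * (g * (2 * φ) + 2 * φ * g) +
        α ^ 2 * (5 / 4 * (g * φ) + g * (2 * φ) * g) := by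
        rw [stepRemainder_eq, map_neg_eq_map]
        refine (map_add_le_add ν _ _).trans (add_le_add ((map_add_le_add ν _ _).trans ?_) ?_)
        · rw [map_smul_eq_mul ν (α ^ 2), map_smul_eq_mul ν α, Real.norm_of_nonneg hα,
            Real.norm_of_nonneg (sq_nonneg α)]
          gcongr
        · rw [map_smul_eq_mul, Real.norm_of_nonneg (sq_nonneg α)]
          gcongr
    _ = α * (g * φ) * (4 + α * (13 / 4 + 2 * g)) := by ring
    _ ≤ α * (g * φ) * 5 := by
        gcongr
        nlinarith [h.maxError_le]
    _ = 5 * (α * (g * φ)) := by ring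

theorem norm_stepRemainder_le (h : IsControlled α A) :
    ‖stepRemainder α A‖ ≤ 5 * (α * (maxError A * maxError A)) := by
  have hF : ‖errorF A * errorF A‖ ≤ maxError A * maxError A :=
    (norm_mul_le _ _).trans (mul_le_mul (norm_errorF_le A) (norm_errorF_le A) (norm_nonneg _)
      (maxError_nonneg A))
  have hFF : (errorF A * errorF A).IsHermitian := by
    rw [Matrix.IsHermitian, Matrix.conjTranspose_eq_transpose_of_trivial, Matrix.transpose_mul,
      errorF_transpose]
  refine h.stepRemainder_le (normSeminorm ℝ _) (fun X Y => norm_mul_le X Y)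
    (fun X Y => norm_mul_le X Y) (norm_errorE_le A) ?_ ?_
  · exact (h.norm_smul_krausMap_le (errorF_transpose A)).trans
      (mul_le_mul_of_nonneg_left (norm_errorF_le A) zero_le_two)
  · exact (h.norm_smul_krausMap_le hFF).trans (mul_le_mul_of_nonneg_left hF zero_le_two)

theorem frob_stepRemainder_le (h : IsControlled α A) :
    frob (stepRemainder α A) ≤ 5 * (α * (maxError A * (√m * rmsError A))) := by
  have hg := maxError_nonneg A
  have hF : frob (errorF A) / √n ≤ rmsError A := le_max_right _ _
  refine h.stepRemainder_le frob frob_mul_le_l2_opNorm_mul frob_mul_le_mul_l2_opNorm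
    (frob_errorE_le A) ?_ ?_
  · exact (h.frob_smul_krausMap_le _).trans (by gcongr)
  · calc frob ((m : ℝ) • krausMap A (errorF A * errorF A))
        ≤ 2 * (√m * (maxError A * frob (errorF A) / √n)) := by
          refine (h.frob_smul_krausMap_le _).trans ?_
          gcongr
          exact (frob_mul_le_l2_opNorm_mul _ _).trans
            (mul_le_mul_of_nonneg_right (norm_errorF_le A) (frob_nonneg _))
      _ = 2 * (maxError A * (√m * (frob (errorF A) / √n))) := by ring
      _ ≤ 2 * (maxError A * (√m * rmsError A)) := by gcongr

theorem abs_trace_krausMap_errorF_le (h : IsControlled α A) :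
    |(krausMap A (errorF A)).trace| ≤ maxError A ^ 2 := by
  have hn : (0 : ℝ) < n := Nat.cast_pos.2 h.right_pos
  have htrace : n * (krausMap A (errorF A)).trace = -frob (errorF A) ^ 2 := by
    rw [trace_krausMap, ← leftMarginal_flip, ← smul_eq_mul, ← Matrix.trace_smul, ← Matrix.smul_mul,
      smul_leftMarginal, size_flip, errorE_flip, sub_mul, Matrix.trace_sub, smul_mul_assoc, one_mul,
      Matrix.trace_smul, trace_errorF, ← trace_transpose_mul_self, errorF_transpose]
    simp
  have hF : frob (errorF A) ^ 2 ≤ n * maxError A ^ 2 := by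
    rw [← Real.sq_sqrt hn.le, ← mul_pow]
    exact pow_le_pow_left₀ (frob_nonneg _) ((frob_errorF_le A).trans
      (mul_le_mul_of_nonneg_left (rmsError_le_maxError A) (Real.sqrt_nonneg _))) 2
  refine le_of_mul_le_mul_left ?_ hn
  rwa [← abs_of_pos hn, ← abs_mul, abs_of_pos hn, htrace, abs_neg, abs_sq]

theorem abs_size_gradientStep_sub_le (h : IsControlled α A) :
    |size (gradientStep α A) - size A| ≤ 7 * α * maxError A ^ 2 := by
  have hm : (0 : ℝ) < m := Nat.cast_pos.2 h.left_pos
  have hα := h.step_nonneg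
  have htrace := congrArg Matrix.trace (errorE_gradientStep α A)
  simp only [trace_errorE, Matrix.trace_add, Matrix.trace_sub, Matrix.trace_smul, smul_eq_mul,
    mul_zero, Matrix.trace_one, Fintype.card_fin] at htrace
  have hR : |(stepRemainder α A).trace| ≤ m * (5 * α * maxError A ^ 2) := by
    refine (abs_trace_le _).trans ?_
    rw [Fintype.card_fin]
    gcongr
    exact h.norm_stepRemainder_le.trans_eq (by ring)
  refine le_of_mul_le_mul_left ?_ hm
  calc m * |size (gradientStep α A) - size A|
      = |m * (2 * α) * (krausMap A (errorF A)).trace - (stepRemainder α A).trace| := by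
        rw [← abs_of_pos hm, ← abs_mul, abs_of_pos hm]
        congr 1
        linear_combination -htrace
    _ ≤ m * (2 * α) * maxError A ^ 2 + m * (5 * α * maxError A ^ 2) := by
        refine (abs_sub _ _).trans (add_le_add ?_ hR)
        rw [abs_mul, abs_of_nonneg (by positivity)]
        gcongr
        exact h.abs_trace_krausMap_errorF_le
    _ = m * (7 * α * maxError A ^ 2) := by ring

theorem norm_errorE_gradientStep_le (h : IsControlled α A) :
    ‖errorE (gradientStep α A)‖ ≤ (1 - 2 * α * size A) * ‖errorE A‖ +
      2 * α * size A * ‖errorF A‖ + 14 * α * maxError A ^ 2 := by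
  have hα := h.step_nonneg
  have hc : 0 ≤ 1 - 2 * α * size A := by linarith [h.two_mul_step_mul_size_le]
  have size_term : ‖(size (gradientStep α A) - size A) • (1 : Matrix (Fin m) (Fin m) ℝ)‖ ≤
      7 * α * maxError A ^ 2 := by
    rw [norm_smul]
    exact (mul_le_of_le_one_right (norm_nonneg _) l2_opNorm_one_le).trans
      h.abs_size_gradientStep_sub_le
  have kraus_term : ‖(2 * α) • ((m : ℝ) • krausMap A (errorF A))‖ ≤
      2 * α * size A * ‖errorF A‖ + 2 * α * maxError A ^ 2 := by
    rw [norm_smul, Real.norm_of_nonneg (by positivity)]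
    calc 2 * α * ‖(m : ℝ) • krausMap A (errorF A)‖
        ≤ 2 * α * (‖errorF A‖ * size A + maxError A * maxError A) := by
          refine mul_le_mul_of_nonneg_left ?_ (by positivity)
          refine (OperatorScaling.norm_smul_krausMap_le A (errorF_transpose A)).trans ?_
          rw [mul_add]
          exact add_le_add_right (mul_le_mul_of_nonneg_right (norm_errorF_le A)
            (maxError_nonneg A)) _
      _ = 2 * α * size A * ‖errorF A‖ + 2 * α * maxError A ^ 2 := by ring
  rw [errorE_gradientStep]
  calc _ ≤ 7 * α * maxError A ^ 2 + ((1 - 2 * α * size A) * ‖errorE A‖ +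
        (2 * α * size A * ‖errorF A‖ + 2 * α * maxError A ^ 2) +
        5 * (α * (maxError A * maxError A))) := by
        refine (norm_add_le _ _).trans (add_le_add size_term ((norm_add_le _ _).trans
          (add_le_add ((norm_sub_le _ _).trans (add_le_add ?_ kraus_term))
            h.norm_stepRemainder_le)))
        rw [norm_smul, Real.norm_of_nonneg hc]
    _ = (1 - 2 * α * size A) * ‖errorE A‖ + 2 * α * size A * ‖errorF A‖ +
        14 * α * maxError A ^ 2 := by ring

theorem maxError_gradientStep_le (h : IsControlled α A) :
    maxError (gradientStep α A) ≤ (1 - 2 * α * size A) * maxError A +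
      2 * α * size A * minError A + 14 * α * maxError A ^ 2 := by
  have hc := h.two_mul_step_mul_size_le
  have hE := h.norm_errorE_gradientStep_le
  have hF := h.flip.norm_errorE_gradientStep_le
  rw [gradientStep_flip, errorE_flip, errorE_flip, errorF_flip, size_flip, maxError_flip] at hF
  set r := 14 * α * maxError A ^ 2
  refine max_le (hE.trans ?_) (hF.trans ?_) <;> gcongr ?_ + r <;> rw [maxError, minError] <;>
    rcases le_total ‖errorE A‖ ‖errorF A‖ with hEF | hEF <;> simp only [hEF, sup_of_le_left,
      sup_of_le_right, inf_of_le_left, inf_of_le_right] <;> nlinarith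

end IsControlled

/-- The spectral gap as a bound on the bilinear form `⟨X, ∑ᵢ Aᵢ Y Aᵢ*⟩` of traceless matrices; for
an operator of size one that is doubly balanced, `κ` is `1` minus the gap. -/
def GapBound (κ : ℝ) (A : Operator k m n) : Prop :=
  ∀ (X : Matrix (Fin m) (Fin m) ℝ) (Y : Matrix (Fin n) (Fin n) ℝ), X.trace = 0 → Y.trace = 0 →
    |(Xᵀ * krausMap A Y).trace| ≤ κ / (√m * √n) * (frob X * frob Y)

theorem GapBound.flip {κ : ℝ} {A : Operator k m n} (h : GapBound κ A) : GapBound κ (flip A) :=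
  fun Y X hY hX => by
    rw [trace_transpose_mul_krausMap_flip, mul_comm √_, mul_comm (frob Y)]
    exact h X Y hX hY

theorem GapBound.neg_natCast_mul_trace_le {κ : ℝ} {A : Operator k m n} (h : GapBound κ A)
    (hκ : 0 ≤ κ) (hn : 0 < n) {X : Matrix (Fin m) (Fin m) ℝ} (hX : X.trace = 0) :
    -(m * (Xᵀ * krausMap A (errorF A)).trace) ≤ κ * (frob X * (√m * rmsError A)) := by
  calc -(m * (Xᵀ * krausMap A (errorF A)).trace)
      ≤ m * (κ / (√m * √n) * (frob X * (√n * rmsError A))) := by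
        rw [← mul_neg]
        gcongr
        exact (neg_le_abs _).trans ((h X _ hX (trace_errorF A)).trans
          (mul_le_mul_of_nonneg_left
            (mul_le_mul_of_nonneg_left (frob_errorF_le A) (frob_nonneg X)) (by positivity)))
    _ = κ * (frob X * (√m * rmsError A)) := by
        nth_rewrite 1 [← Real.mul_self_sqrt (Nat.cast_nonneg m : (0 : ℝ) ≤ m)]
        field_simp

theorem frob_conj_one_add_sub_le {ι : Type*} [Fintype ι] [DecidableEq ι] {Z : Matrix ι ι ℝ}
    (hZ : ‖Z‖ ≤ 1) (X : Matrix ι ι ℝ) :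
    frob ((1 + Z) * X * (1 + Z) - X) ≤ 3 * ‖Z‖ * frob X := by
  have hZX := frob_mul_le_l2_opNorm_mul Z X
  have expansion : (1 + Z) * X * (1 + Z) - X = Z * X + X * Z + Z * X * Z := by noncomm_ring
  rw [expansion]
  calc frob (Z * X + X * Z + Z * X * Z)
      ≤ ‖Z‖ * frob X + frob X * ‖Z‖ + ‖Z‖ * frob X * 1 := by
        refine (map_add_le_add frob _ _).trans (add_le_add ((map_add_le_add frob _ _).trans
          (add_le_add hZX (frob_mul_le_mul_l2_opNorm X Z))) ?_)
        exact (frob_mul_le_mul_l2_opNorm _ _).trans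
          (mul_le_mul hZX hZ (norm_nonneg Z) (by positivity))
    _ = 3 * ‖Z‖ * frob X := by ring

theorem trace_transpose_mul_krausMap_gradientStep (α : ℝ) (A : Operator k m n)
    (X : Matrix (Fin m) (Fin m) ℝ) (Y : Matrix (Fin n) (Fin n) ℝ) :
    (Xᵀ * krausMap (gradientStep α A) Y).trace =
      (((1 + α • errorE A) * X * (1 + α • errorE A))ᵀ *
        krausMap A ((1 + α • errorF A) * Y * (1 + α • errorF A))).trace := by
  have hL : (1 + α • errorE A)ᵀ = 1 + α • errorE A := by simp [errorE_transpose]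
  rw [krausMap_gradientStep, Matrix.transpose_mul, Matrix.transpose_mul, hL, ← Matrix.mul_assoc,
    Matrix.trace_mul_comm]
  simp only [Matrix.mul_assoc]

namespace IsControlled

variable {α κ : ℝ} {A : Operator k m n}

theorem frob_errorE_gradientStep_le (h : IsControlled α A) (hκ : 0 ≤ κ) (hgap : GapBound κ A) :
    frob (errorE (gradientStep α A)) ≤
      √m * ((1 - 2 * α * (size A - κ) + 5 * α * maxError A) * rmsError A) := by
  have hα := h.step_nonneg
  have hc : 0 ≤ 1 - 2 * α * size A := by linarith [h.two_mul_step_mul_size_le]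
  have hg := maxError_nonneg A
  have hr := rmsError_nonneg A
  set E' := errorE (gradientStep α A) with hE'
  have hE'0 := frob_nonneg E'
  have expansion : frob E' ^ 2 = (1 - 2 * α * size A) * (E'ᵀ * errorE A).trace -
      2 * α * (m * (E'ᵀ * krausMap A (errorF A)).trace) + (E'ᵀ * stepRemainder α A).trace := by
    rw [← trace_transpose_mul_self]
    nth_rewrite 2 [hE']
    simp only [errorE_gradientStep, mul_add, mul_sub, Matrix.mul_smul, mul_one, Matrix.trace_add,
      Matrix.trace_sub, Matrix.trace_smul, Matrix.trace_transpose, smul_eq_mul]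
    rw [hE', trace_errorE]
    ring
  have contraction_term : (E'ᵀ * errorE A).trace ≤ frob E' * (√m * rmsError A) :=
    (le_abs_self _).trans ((abs_trace_transpose_mul_le _ _).trans
      (mul_le_mul_of_nonneg_left (frob_errorE_le A) hE'0))
  have gap_term := hgap.neg_natCast_mul_trace_le hκ h.right_pos (trace_errorE (gradientStep α A))
  have remainder_term : (E'ᵀ * stepRemainder α A).trace ≤
      frob E' * (5 * (α * (maxError A * (√m * rmsError A)))) :=
    (le_abs_self _).trans ((abs_trace_transpose_mul_le _ _).trans
      (mul_le_mul_of_nonneg_left h.frob_stepRemainder_le hE'0))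
  rcases hE'0.eq_or_lt with hE'0 | hE'0
  · rw [← hE'0]
    have : 0 ≤ 1 - 2 * α * (size A - κ) + 5 * α * maxError A := by nlinarith [mul_nonneg hα hκ]
    positivity
  · refine le_of_mul_le_mul_left ?_ hE'0
    nlinarith [mul_le_mul_of_nonneg_left contraction_term hc,
      mul_le_mul_of_nonneg_left gap_term (mul_nonneg zero_le_two hα)]

theorem rmsError_gradientStep_le (h : IsControlled α A) (hκ : 0 ≤ κ) (hgap : GapBound κ A) :
    rmsError (gradientStep α A) ≤
      (1 - 2 * α * (size A - κ) + 5 * α * maxError A) * rmsError A := by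
  have hE := h.frob_errorE_gradientStep_le hκ hgap
  have hF := h.flip.frob_errorE_gradientStep_le hκ hgap.flip
  rw [gradientStep_flip, errorE_flip, size_flip, maxError_flip, rmsError_flip] at hF
  have hm : 0 < √(m : ℝ) := Real.sqrt_pos.2 (Nat.cast_pos.2 h.left_pos)
  have hn : 0 < √(n : ℝ) := Real.sqrt_pos.2 (Nat.cast_pos.2 h.right_pos)
  exact max_le ((div_le_iff₀' hm).2 hE) ((div_le_iff₀' hn).2 hF)

theorem step_mul_maxError_le (h : IsControlled α A) : α * maxError A ≤ 1 / 32 :=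
  (mul_le_mul h.step_le h.maxError_le (maxError_nonneg A) (by norm_num)).trans (by norm_num)

theorem norm_smul_errorE_le (h : IsControlled α A) : ‖α • errorE A‖ ≤ α * maxError A := by
  rw [norm_smul, Real.norm_of_nonneg h.step_nonneg]
  exact mul_le_mul_of_nonneg_left (norm_errorE_le A) h.step_nonneg

theorem frob_conj_sub_le (h : IsControlled α A) (X : Matrix (Fin m) (Fin m) ℝ) :
    frob ((1 + α • errorE A) * X * (1 + α • errorE A) - X) ≤ 3 * (α * maxError A) * frob X := by
  have hE := h.norm_smul_errorE_le
  refine (frob_conj_one_add_sub_le (by linarith [h.step_mul_maxError_le]) X).trans ?_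
  gcongr

theorem gapBound_gradientStep (h : IsControlled α A) (hgap : GapBound κ A) :
    GapBound (κ + 18 * (α * maxError A)) (gradientStep α A) := by
  intro X Y hX hY
  set δ := α * maxError A
  have hY0 := frob_nonneg Y
  have hdX : frob ((1 + α • errorE A) * X * (1 + α • errorE A) - X) ≤ 3 * δ * frob X :=
    h.frob_conj_sub_le X
  have hdY : frob ((1 + α • errorF A) * Y * (1 + α • errorF A) - Y) ≤ 3 * δ * frob Y := by
    simpa only [errorE_flip, maxError_flip] using h.flip.frob_conj_sub_le Y
  rw [trace_transpose_mul_krausMap_gradientStep]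
  set X' := (1 + α • errorE A) * X * (1 + α • errorE A)
  set Y' := (1 + α • errorF A) * Y * (1 + α • errorF A)
  have hY' : frob Y' ≤ 2 * frob Y := by
    have := map_add_le_add frob (Y' - Y) Y
    rw [sub_add_cancel] at this
    nlinarith [h.step_mul_maxError_le]
  have bound_le {U : Matrix (Fin m) (Fin m) ℝ} {V : Matrix (Fin n) (Fin n) ℝ} {u v : ℝ}
      (hU : frob U ≤ u) (hV : frob V ≤ v) :
      |(Uᵀ * krausMap A V).trace| ≤ 2 / (√m * √n) * (u * v) :=
    (abs_trace_transpose_mul_krausMap_le A U V).trans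
      (mul_le_mul h.sqrt_norm_marginals_le
        (mul_le_mul hU hV (frob_nonneg V) ((frob_nonneg U).trans hU))
        (mul_nonneg (frob_nonneg U) (frob_nonneg V)) (by positivity))
  have decomposition : (X'ᵀ * krausMap A Y').trace = (Xᵀ * krausMap A Y).trace +
      (Xᵀ * krausMap A (Y' - Y)).trace + ((X' - X)ᵀ * krausMap A Y').trace := by
    rw [← Matrix.trace_add, ← Matrix.trace_add, ← mul_add, ← map_add, add_sub_cancel, ← add_mul,
      ← Matrix.transpose_add, add_sub_cancel]
  calc |(X'ᵀ * krausMap A Y').trace|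
      ≤ κ / (√m * √n) * (frob X * frob Y) + 2 / (√m * √n) * (frob X * (3 * δ * frob Y)) +
        2 / (√m * √n) * ((3 * δ * frob X) * (2 * frob Y)) := by
        rw [decomposition]
        exact (abs_add_three _ _ _).trans
          (add_le_add_three (hgap X Y hX hY) (bound_le le_rfl hdY) (bound_le hdX hY'))
    _ = (κ + 18 * δ) / (√m * √n) * (frob X * frob Y) := by ring

theorem isScaling_gradientStep {A₀ : Operator k m n} (h : IsControlled α A)
    (hA : IsScaling A₀ A) : IsScaling A₀ (gradientStep α A) := by
  obtain ⟨L, R, hL, hR, hA⟩ := hA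
  have isUnit_factor {d : ℕ} {Z : Matrix (Fin d) (Fin d) ℝ} (hZ : ‖Z‖ ≤ α * maxError A) :
      IsUnit (1 + Z) := by
    rw [← sub_neg_eq_add]
    exact isUnit_one_sub_of_norm_lt_one
      (by rw [norm_neg]; linarith [h.step_mul_maxError_le])
  have hF : ‖α • errorF A‖ ≤ α * maxError A := by
    simpa only [errorE_flip, maxError_flip] using h.flip.norm_smul_errorE_le
  refine ⟨(1 + α • errorE A) * L, R * (1 + α • errorF A),
    (isUnit_factor h.norm_smul_errorE_le).mul hL, hR.mul (isUnit_factor hF), fun i => ?_⟩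
  simp only [gradientStep, hA i, Matrix.mul_assoc]

end IsControlled

end GradientStep

section SingularValues

theorem sum_mul_le_sum_range_of_antitone {σ : ℕ → ℝ} (hσ : Antitone σ) {N r : ℕ} {w : Fin N → ℝ}
    (w_nonneg : ∀ j, 0 ≤ w j) (w_le_one : ∀ j, w j ≤ 1) (sum_w : ∑ j, w j = r) :
    ∑ j : Fin N, σ j * w j ≤ ∑ i ∈ Finset.range r, σ i := by
  have hr : r ≤ N := by
    have h : ∑ j, w j ≤ ∑ _j : Fin N, 1 := Finset.sum_le_sum fun j _ => w_le_one j
    rw [sum_w] at h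
    simpa using h
  have shifted_le (j : Fin N) : (σ j - σ r) * w j ≤ if (j : ℕ) < r then σ j - σ r else 0 := by
    split_ifs with hj
    · exact mul_le_of_le_one_right (sub_nonneg.2 (hσ hj.le)) (w_le_one j)
    · exact mul_nonpos_of_nonpos_of_nonneg (sub_nonpos.2 (hσ (not_lt.1 hj))) (w_nonneg j)
  calc ∑ j : Fin N, σ j * w j = ∑ j : Fin N, (σ j - σ r) * w j + σ r * r := by
        rw [← sum_w, Finset.mul_sum, ← Finset.sum_add_distrib]
        exact Finset.sum_congr rfl fun j _ => by ring
    _ ≤ ∑ j : Fin N, (if (j : ℕ) < r then σ j - σ r else 0) + σ r * r := by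
        gcongr with j
        exact shifted_le j
    _ = ∑ i ∈ Finset.range r, (σ i - σ r) + σ r * r := by
        rw [Fin.sum_univ_eq_sum_range (fun j => if j < r then σ j - σ r else 0),
          ← Finset.sum_filter]
        congr 2
        grind
    _ = ∑ i ∈ Finset.range r, σ i := by simp [mul_comm]

variable {𝕜 E F : Type*} [RCLike 𝕜] [NormedAddCommGroup E] [InnerProductSpace 𝕜 E]
  [FiniteDimensional 𝕜 E] [NormedAddCommGroup F] [InnerProductSpace 𝕜 F] [FiniteDimensional 𝕜 F]

theorem norm_apply_sq_eq_sum_singularValues (T : E →ₗ[𝕜] F) {N : ℕ}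
    (hN : Module.finrank 𝕜 E = N) (x : E) :
    ‖T x‖ ^ 2 = ∑ i : Fin N, T.singularValues i ^ 2 *
      ‖inner 𝕜 (T.isSymmetric_adjoint_comp_self.eigenvectorBasis hN i) x‖ ^ 2 := by
  set b := T.isSymmetric_adjoint_comp_self.eigenvectorBasis hN
  have inner_basis (i : Fin N) : inner 𝕜 (b i) ((T.adjoint ∘ₗ T) x) =
      (T.singularValues i ^ 2 : ℝ) * inner 𝕜 (b i) x := by
    rw [T.sq_singularValues_fin hN, ← b.repr_apply_apply, ← b.repr_apply_apply]
    exact T.isSymmetric_adjoint_comp_self.eigenvectorBasis_apply_self_apply hN x i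
  calc ‖T x‖ ^ 2 = RCLike.re (inner 𝕜 x ((T.adjoint ∘ₗ T) x)) := by
        rw [LinearMap.comp_apply, LinearMap.adjoint_inner_right, norm_sq_eq_re_inner (𝕜 := 𝕜)]
    _ = ∑ i : Fin N,
          RCLike.re ((T.singularValues i ^ 2 : ℝ) * (inner 𝕜 x (b i) * inner 𝕜 (b i) x)) := by
        rw [← b.sum_inner_mul_inner, map_sum]
        simp only [inner_basis, mul_left_comm]
    _ = ∑ i : Fin N, T.singularValues i ^ 2 * ‖inner 𝕜 (b i) x‖ ^ 2 := by
        simp only [RCLike.re_ofReal_mul, inner_mul_symm_re_eq_norm, norm_mul,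
          norm_inner_symm x, ← sq]

theorem sum_norm_apply_sq_le_sum_singularValues_sq (T : E →ₗ[𝕜] F) {r : ℕ} {v : Fin r → E}
    (hv : Orthonormal 𝕜 v) :
    ∑ i, ‖T (v i)‖ ^ 2 ≤ ∑ i ∈ Finset.range r, T.singularValues i ^ 2 := by
  obtain ⟨N, hN⟩ : ∃ N, Module.finrank 𝕜 E = N := ⟨_, rfl⟩
  set b := T.isSymmetric_adjoint_comp_self.eigenvectorBasis hN
  let w (j : Fin N) : ℝ := ∑ i, ‖inner 𝕜 (b j) (v i)‖ ^ 2
  have w_le_one (j) : w j ≤ 1 := by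
    simpa [w, norm_inner_symm (b j)] using hv.sum_inner_products_le (b j) (s := Finset.univ)
  have sum_w : ∑ j, w j = r := by
    rw [Finset.sum_comm]
    simp [b.sum_sq_norm_inner_right, hv.1]
  have antitone : Antitone fun i => T.singularValues i ^ 2 := fun i j hij =>
    pow_le_pow_left₀ (T.singularValues_nonneg j) (T.singularValues_antitone hij) 2
  calc ∑ i, ‖T (v i)‖ ^ 2 = ∑ j : Fin N, T.singularValues j ^ 2 * w j := by
        simp only [norm_apply_sq_eq_sum_singularValues T hN, w, Finset.mul_sum]
        exact Finset.sum_comm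
    _ ≤ ∑ i ∈ Finset.range r, T.singularValues i ^ 2 :=
        sum_mul_le_sum_range_of_antitone antitone
          (fun _ => Finset.sum_nonneg fun _ _ => sq_nonneg _) w_le_one sum_w

theorem singularValues_le_of_norm_apply_le (T : E →ₗ[𝕜] F) {c : ℝ} (hc : 0 ≤ c)
    (hT : ∀ x, ‖T x‖ ≤ c * ‖x‖) (i : ℕ) : T.singularValues i ≤ c := by
  obtain hi | hi := le_or_gt (Module.finrank 𝕜 E) i
  · rwa [T.singularValues_of_finrank_le hi]
  obtain ⟨x, hx⟩ := (T.hasEigenvalue_adjoint_comp_self_sq_singularValues hi).exists_hasEigenvector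
  have hxpos : 0 < ‖x‖ := norm_pos_iff.2 hx.2
  have norm_apply : ‖T x‖ = T.singularValues i * ‖x‖ := by
    rw [← sq_eq_sq₀ (norm_nonneg _) (mul_nonneg (T.singularValues_nonneg i) hxpos.le)]
    have h := congrArg (fun y => RCLike.re (inner 𝕜 x y)) hx.apply_eq_smul
    rw [LinearMap.comp_apply, LinearMap.adjoint_inner_right, ← norm_sq_eq_re_inner] at h
    rw [h]
    simp [mul_pow, inner_smul_right]
  exact le_of_mul_le_mul_right (norm_apply ▸ hT x) hxpos

end SingularValues

section InitialState

variable {k m n : ℕ}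

theorem toEuclideanLin_naturalMatrix_vec (A : Operator k m n) (Y : Matrix (Fin n) (Fin n) ℝ) :
    Matrix.toEuclideanLin (naturalMatrix A) (WithLp.toLp 2 Y.vec) =
      WithLp.toLp 2 (krausMap A Y).vec := by
  rw [Matrix.toLpLin_toLp, Matrix.toLin'_apply, naturalMatrix, Matrix.sum_mulVec, krausMap_apply]
  simp only [Matrix.kronecker_mulVec_vec, Matrix.vec_sum]

theorem singularValues_naturalMatrix_le (A : Operator k m n) (i : ℕ) :
    (Matrix.toEuclideanLin (naturalMatrix A)).singularValues i ≤
      √‖leftMarginal A‖ * √‖rightMarginal A‖ := by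
  refine singularValues_le_of_norm_apply_le _ (by positivity) (fun x => ?_) i
  obtain ⟨Y, rfl⟩ : ∃ Y : Matrix (Fin n) (Fin n) ℝ, WithLp.toLp 2 Y.vec = x :=
    ⟨Matrix.of fun a b => x (b, a), rfl⟩
  rw [toEuclideanLin_naturalMatrix_vec, ← frob_eq_norm_vec, ← frob_eq_norm_vec]
  exact frob_krausMap_le A Y

theorem frob_krausMap_sq_add_le (A : Operator k m n) {X Y : Matrix (Fin n) (Fin n) ℝ}
    (hX : frob X = 1) (hY : frob Y = 1) (hXY : (Xᵀ * Y).trace = 0) :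
    frob (krausMap A X) ^ 2 + frob (krausMap A Y) ^ 2 ≤
      (Matrix.toEuclideanLin (naturalMatrix A)).singularValues 0 ^ 2 +
        (Matrix.toEuclideanLin (naturalMatrix A)).singularValues 1 ^ 2 := by
  have orthonormal : Orthonormal ℝ ![WithLp.toLp 2 X.vec, WithLp.toLp 2 Y.vec] := by
    have hYX := hXY
    rw [trace_transpose_mul_comm] at hYX
    rw [orthonormal_iff_ite]
    simp [Fin.forall_fin_two, inner_vec, ← frob_eq_norm_vec, hX, hY, hXY, hYX]
  have h := sum_norm_apply_sq_le_sum_singularValues_sq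
    (Matrix.toEuclideanLin (naturalMatrix A)) orthonormal
  simpa [Fin.sum_univ_two, Finset.sum_range_succ, -Matrix.toLpLin_toLp,
    toEuclideanLin_naturalMatrix_vec, ← frob_eq_norm_vec] using h

theorem size_sq_le (A : Operator k m n) : size A ^ 2 ≤ m * frob (leftMarginal A) ^ 2 := by
  have h := abs_trace_transpose_mul_le 1 (leftMarginal A)
  rw [Matrix.transpose_one, Matrix.one_mul, trace_leftMarginal, frob_one, Fintype.card_fin] at h
  calc size A ^ 2 = |size A| ^ 2 := (sq_abs _).symm
    _ ≤ (√m * frob (leftMarginal A)) ^ 2 := by gcongr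
    _ = m * frob (leftMarginal A) ^ 2 := by rw [mul_pow, Real.sq_sqrt (Nat.cast_nonneg m)]

theorem frob_krausMap_sq_le_of_trace_eq_zero (A : Operator k m n) (hm : 0 < m) (hn : 0 < n)
    {Y : Matrix (Fin n) (Fin n) ℝ} (hY : Y.trace = 0) :
    frob (krausMap A Y) ^ 2 ≤
      ((Matrix.toEuclideanLin (naturalMatrix A)).singularValues 0 ^ 2 +
        (Matrix.toEuclideanLin (naturalMatrix A)).singularValues 1 ^ 2 -
        size A ^ 2 / (m * n)) * frob Y ^ 2 := by
  obtain hY0 | hYpos := (frob_nonneg Y).eq_or_lt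
  · have h := frob_krausMap_le A Y
    rw [← hY0, mul_zero] at h
    simp [← hY0, h.antisymm (frob_nonneg _)]
  have frob_unit : frob ((√n)⁻¹ • (1 : Matrix (Fin n) (Fin n) ℝ)) = 1 := by
    rw [frob_smul, frob_one, Fintype.card_fin, abs_of_pos (by positivity)]
    exact inv_mul_cancel₀ (by positivity)
  have frob_normalized : frob ((frob Y)⁻¹ • Y) = 1 := by
    rw [frob_smul, abs_of_pos (by positivity), inv_mul_cancel₀ hYpos.ne']
  have kyFan := frob_krausMap_sq_add_le A frob_unit frob_normalized (by simp [hY])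
  have unit_ge : size A ^ 2 / (m * n) ≤
      frob (krausMap A ((√n)⁻¹ • (1 : Matrix (Fin n) (Fin n) ℝ))) ^ 2 := by
    rw [map_smul, krausMap_one, frob_smul, mul_pow, sq_abs, inv_pow,
      Real.sq_sqrt (Nat.cast_nonneg n), div_le_iff₀ (by positivity)]
    refine (size_sq_le A).trans_eq ?_
    field_simp
  rw [map_smul _ (frob Y)⁻¹, frob_smul (frob Y)⁻¹, mul_pow, sq_abs] at kyFan
  rw [← div_le_iff₀ (by positivity), div_eq_inv_mul, ← inv_pow]
  linarith

theorem frob_krausMap_le_of_hasSpectralGap {A : Operator k m n} {ε lam : ℝ} (hm : 0 < m)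
    (hn : 0 < n) (hlam : 0 ≤ lam) (hlam1 : lam ≤ 1) (hε : 0 ≤ ε) (hεlam : 12 * ε ≤ lam ^ 2)
    (hA : maxError A ≤ ε * size A) (hgap : HasSpectralGap lam A) {Y : Matrix (Fin n) (Fin n) ℝ}
    (hY : Y.trace = 0) :
    frob (krausMap A Y) ≤ (1 - lam / 2) * size A / (√m * √n) * frob Y := by
  set q := size A / (√m * √n) with hq
  have hq0 : 0 ≤ q := div_nonneg (size_nonneg A) (by positivity)
  have hq2 : size A ^ 2 / (m * n) = q ^ 2 := by
    rw [hq, div_pow, mul_pow, Real.sq_sqrt (Nat.cast_nonneg _), Real.sq_sqrt (Nat.cast_nonneg _)]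
  rw [HasSpectralGap, Real.sqrt_mul (Nat.cast_nonneg m), ← hq] at hgap
  have first_le : (Matrix.toEuclideanLin (naturalMatrix A)).singularValues 0 ≤ (1 + ε) * q := by
    refine (singularValues_naturalMatrix_le A 0).trans ((sqrt_norm_marginals_le A hm hn).trans ?_)
    rw [hq, ← mul_div_assoc]
    gcongr
    linarith
  have coefficient_le : (1 + ε) ^ 2 + (1 - lam) ^ 2 - 1 ≤ (1 - lam / 2) ^ 2 := by
    have hlam2 : lam ^ 2 ≤ lam := pow_le_of_le_one hlam hlam1 two_ne_zero
    have hε2 : ε ^ 2 ≤ ε := pow_le_of_le_one hε (by linarith) two_ne_zero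
    linarith
  rw [mul_div_assoc, ← hq]
  refine abs_le_of_sq_le_sq' ?_
    (mul_nonneg (mul_nonneg (by linarith) hq0) (frob_nonneg Y)) |>.2
  calc frob (krausMap A Y) ^ 2
      ≤ (((1 + ε) * q) ^ 2 + ((1 - lam) * q) ^ 2 - q ^ 2) * frob Y ^ 2 := by
        refine (frob_krausMap_sq_le_of_trace_eq_zero A hm hn hY).trans ?_
        rw [hq2]
        gcongr <;> exact LinearMap.singularValues_nonneg _ _
    _ = ((1 + ε) ^ 2 + (1 - lam) ^ 2 - 1) * (q * frob Y) ^ 2 := by ring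
    _ ≤ (1 - lam / 2) ^ 2 * (q * frob Y) ^ 2 := by gcongr
    _ = ((1 - lam / 2) * q * frob Y) ^ 2 := by ring

theorem HasSpectralGap.gapBound {A : Operator k m n} {ε lam : ℝ} (hgap : HasSpectralGap lam A)
    (hm : 0 < m) (hn : 0 < n) (hlam : 0 ≤ lam) (hlam1 : lam ≤ 1) (hε : 0 ≤ ε)
    (hεlam : 12 * ε ≤ lam ^ 2) (hA : maxError A ≤ ε * size A) :
    GapBound ((1 - lam / 2) * size A) A := fun X Y _ hY => by
  calc |(Xᵀ * krausMap A Y).trace| ≤ frob X * frob (krausMap A Y) := abs_trace_transpose_mul_le _ _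
    _ ≤ frob X * ((1 - lam / 2) * size A / (√m * √n) * frob Y) := by
        gcongr
        exact frob_krausMap_le_of_hasSpectralGap hm hn hlam hlam1 hε hεlam hA hgap hY
    _ = (1 - lam / 2) * size A / (√m * √n) * (frob X * frob Y) := by ring

theorem HasSpectralGap.le_one {lam : ℝ} {A : Operator k m n} (hgap : HasSpectralGap lam A)
    (hm : 0 < m) (hn : 0 < n) (hA : 0 < size A) : lam ≤ 1 := by
  have h : 0 ≤ (1 - lam) * (size A / √((m : ℝ) * n)) :=
    (LinearMap.singularValues_nonneg _ 1).trans hgap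
  linarith [nonneg_of_mul_nonneg_left h (by positivity)]

theorem IsNearlyDoublyBalanced.nonneg {ε : ℝ} {A : Operator k m n}
    (h : IsNearlyDoublyBalanced ε A) (hm : 0 < m) (hA : 0 < size A) : 0 ≤ ε := by
  have trace_nonneg := (h.1.add h.2.1).trace_nonneg
  rw [sub_add_sub_cancel', ← sub_smul, ← sub_mul, Matrix.trace_smul, Matrix.trace_one,
    Fintype.card_fin, smul_eq_mul] at trace_nonneg
  have h : (1 + ε - (1 - ε)) * (size A / m) * m = 2 * ε * size A := by
    field_simp
    ring
  nlinarith

theorem norm_errorE_le_iff {c : ℝ} (A : Operator k m n) (hm : 0 < m) (hc : 0 ≤ c) :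
    ‖errorE A‖ ≤ c * size A ↔
      (leftMarginal A - ((1 - c) * (size A / m)) • (1 : Matrix (Fin m) (Fin m) ℝ)).PosSemidef ∧
      (((1 + c) * (size A / m)) • (1 : Matrix (Fin m) (Fin m) ℝ) - leftMarginal A).PosSemidef := by
  have hm' : (m : ℝ) ≠ 0 := by positivity
  have posSemidef_smul_iff (X : Matrix (Fin m) (Fin m) ℝ) :
      ((m : ℝ) • X).PosSemidef ↔ X.PosSemidef := by
    refine ⟨fun h => ?_, fun h => h.smul (Nat.cast_nonneg m)⟩
    simpa [smul_smul, hm'] using h.smul (inv_nonneg.2 (Nat.cast_nonneg (α := ℝ) m))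
  have h_size : (m : ℝ) * (size A / m) = size A := by field_simp
  rw [l2_opNorm_le_iff_posSemidef (X := errorE A) (errorE_transpose A)
      (mul_nonneg hc (size_nonneg A)),
    ← posSemidef_smul_iff (leftMarginal A - _), ← posSemidef_smul_iff (_ - leftMarginal A),
    smul_sub, smul_sub, smul_smul, smul_smul, mul_left_comm, mul_left_comm (m : ℝ), h_size, errorE]
  congr! 2 <;> module

theorem isNearlyDoublyBalanced_iff_maxError_le {c : ℝ} (A : Operator k m n) (hm : 0 < m)
    (hn : 0 < n) (hc : 0 ≤ c) : IsNearlyDoublyBalanced c A ↔ maxError A ≤ c * size A := by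
  rw [maxError, max_le_iff, ← errorE_flip, norm_errorE_le_iff A hm hc, ← size_flip A,
    norm_errorE_le_iff (flip A) hn hc, leftMarginal_flip, size_flip, IsNearlyDoublyBalanced,
    and_assoc]

theorem krausMap_smul (c : ℝ) (A : Operator k m n) : krausMap (c • A) = c ^ 2 • krausMap A := by
  ext1 Y
  simp only [krausMap_apply, LinearMap.smul_apply, Pi.smul_apply, Matrix.transpose_smul,
    Matrix.smul_mul, Matrix.mul_smul, smul_smul, Finset.smul_sum, sq]

theorem size_smul (c : ℝ) (A : Operator k m n) : size (c • A) = c ^ 2 * size A := by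
  rw [← trace_leftMarginal, ← krausMap_one, krausMap_smul, LinearMap.smul_apply, krausMap_one,
    Matrix.trace_smul, trace_leftMarginal, smul_eq_mul]

theorem errorE_smul (c : ℝ) (A : Operator k m n) : errorE (c • A) = c ^ 2 • errorE A := by
  rw [errorE, errorE, size_smul, ← krausMap_one, krausMap_smul, LinearMap.smul_apply, krausMap_one]
  module

theorem maxError_smul (c : ℝ) (A : Operator k m n) : maxError (c • A) = c ^ 2 * maxError A := by
  have flip_smul : flip (c • A) = c • flip A := funext fun i => Matrix.transpose_smul c (A i)
  rw [maxError, maxError, ← errorE_flip, flip_smul, errorE_smul, errorE_smul, errorE_flip,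
    norm_smul, norm_smul, Real.norm_of_nonneg (sq_nonneg c), mul_max_of_nonneg _ _ (sq_nonneg c)]

theorem GapBound.smul {κ : ℝ} {A : Operator k m n} (h : GapBound κ A) (c : ℝ) :
    GapBound (c ^ 2 * κ) (c • A) := fun X Y hX hY => by
  rw [krausMap_smul, LinearMap.smul_apply, Matrix.mul_smul, Matrix.trace_smul, smul_eq_mul,
    abs_mul, abs_of_nonneg (sq_nonneg c), mul_div_assoc, mul_assoc]
  exact mul_le_mul_of_nonneg_left (h X Y hX hY) (sq_nonneg c)

theorem normalize_eq_smul (A : Operator k m n) : normalize A = (√(size A))⁻¹ • A := rfl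

theorem inv_sqrt_size_sq_mul_size {A : Operator k m n} (hA : 0 < size A) :
    (√(size A))⁻¹ ^ 2 * size A = 1 := by
  rw [inv_pow, Real.sq_sqrt hA.le, inv_mul_cancel₀ hA.ne']

theorem size_normalize {A : Operator k m n} (hA : 0 < size A) : size (normalize A) = 1 := by
  rw [normalize_eq_smul, size_smul, inv_sqrt_size_sq_mul_size hA]

theorem maxError_normalize_le {c : ℝ} {A : Operator k m n} (hA : 0 < size A)
    (h : maxError A ≤ c * size A) : maxError (normalize A) ≤ c := by
  calc maxError (normalize A) ≤ (√(size A))⁻¹ ^ 2 * (c * size A) := by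
        rw [normalize_eq_smul, maxError_smul]
        gcongr
    _ = c := by rw [mul_left_comm, inv_sqrt_size_sq_mul_size hA, mul_one]

theorem GapBound.normalize {κ : ℝ} {A : Operator k m n} (h : GapBound (κ * size A) A)
    (hA : 0 < size A) : GapBound κ (normalize A) := by
  rw [normalize_eq_smul]
  simpa only [mul_left_comm, inv_sqrt_size_sq_mul_size hA, mul_one] using h.smul (√(size A))⁻¹

theorem isScaling_normalize {A : Operator k m n} (hA : 0 < size A) :
    IsScaling A (normalize A) :=
  ⟨(√(size A))⁻¹ • 1, 1,
    isUnit_one.smul (Units.mk0 (√(size A))⁻¹ (inv_ne_zero (Real.sqrt_pos.2 hA).ne')),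
    isUnit_one, fun i => by simp [OperatorScaling.normalize]⟩

end InitialState

section Dynamics

theorem one_sub_pow_le_inv_of_log_div_le {x b : ℝ} {t : ℕ} (hx : 0 < x) (hx1 : x ≤ 1) (hb : 0 < b)
    (ht : Real.log b / x ≤ t) : (1 - x) ^ t ≤ b⁻¹ := by
  rw [div_le_iff₀' hx] at ht
  calc (1 - x) ^ t ≤ Real.exp (-x) ^ t :=
        pow_le_pow_left₀ (sub_nonneg.2 hx1) (Real.one_sub_le_exp_neg x) t
    _ = Real.exp (-(x * t)) := by rw [← Real.exp_nat_mul, mul_neg, mul_comm]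
    _ ≤ Real.exp (-Real.log b) := by gcongr
    _ = b⁻¹ := by rw [Real.exp_neg, Real.exp_log hb]

theorem sum_min_mul_pow_le {a c ρ : ℝ} (ha : 0 ≤ a) (hc : 0 ≤ c) (hρ : 0 ≤ ρ) (hρ1 : ρ < 1)
    (T t : ℕ) :
    ∑ j ∈ Finset.range t, min c (a * ρ ^ j) ≤ c * T + a * ρ ^ T / (1 - ρ) := by
  calc ∑ j ∈ Finset.range t, min c (a * ρ ^ j)
      ≤ ∑ j ∈ Finset.range (T + t), min c (a * ρ ^ j) :=
        Finset.sum_le_sum_of_subset_of_nonneg (Finset.range_mono (Nat.le_add_left t T))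
          fun _ _ _ => by positivity
    _ = ∑ j ∈ Finset.range T, min c (a * ρ ^ j) +
          ∑ j ∈ Finset.range t, min c (a * ρ ^ (T + j)) := Finset.sum_range_add _ _ _
    _ ≤ ∑ _j ∈ Finset.range T, c + ∑ j ∈ Finset.range t, a * ρ ^ T * ρ ^ j := by
        gcongr with j _ j _
        · exact min_le_left _ _
        · exact (min_le_right _ _).trans_eq (by rw [pow_add, mul_assoc])
    _ ≤ c * T + a * ρ ^ T / (1 - ρ) := by
        rw [Finset.sum_const, Finset.card_range, nsmul_eq_mul, mul_comm, ← Finset.mul_sum,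
          div_eq_mul_inv, ← tsum_geometric_of_lt_one hρ hρ1]
        gcongr
        exact (summable_geometric_of_lt_one hρ hρ1).sum_le_tsum _ fun _ _ => pow_nonneg hρ _

theorem sum_min_mul_one_sub_pow_le {b c x : ℝ} (hb : 1 ≤ b) (hc : 0 ≤ c) (hx : 0 < x)
    (hx1 : x ≤ 1) (t : ℕ) :
    ∑ j ∈ Finset.range t, min c (b * (1 - x) ^ j) ≤ c * (Real.log b / x + 1) + 1 / x := by
  have hb0 : 0 < b := one_pos.trans_le hb
  set T := ⌈Real.log b / x⌉₊
  have T_le : T ≤ Real.log b / x + 1 :=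
    (Nat.ceil_lt_add_one (div_nonneg (Real.log_nonneg hb) hx.le)).le
  have tail_le : b * (1 - x) ^ T ≤ 1 := by
    rw [← le_inv_mul_iff₀ hb0, mul_one]
    exact one_sub_pow_le_inv_of_log_div_le hx hx1 hb0 (Nat.le_ceil _)
  refine (sum_min_mul_pow_le hb0.le hc (sub_nonneg.2 hx1) (by linarith) T t).trans ?_
  rw [sub_sub_cancel]
  gcongr

theorem half_le_log_of_two_le {d : ℕ} (hd : 2 ≤ d) : 1 / 2 ≤ Real.log d := by
  have h : Real.log 2 ≤ Real.log d := Real.log_le_log two_pos (by exact_mod_cast hd)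
  linarith [Real.log_two_gt_d9]

theorem step_mul_sum_min_le {α lam : ℝ} {d : ℕ} (hα : 0 < α) (hα8 : α ≤ 1 / 8) (hlam : 0 < lam)
    (hlam1 : lam ≤ 1) (hd : 2 ≤ d) (t : ℕ) :
    α * ∑ j ∈ Finset.range t, min 2 (√d * (1 - α * lam / 4) ^ j) ≤
      13 * (Real.log d / lam) := by
  have hαlam : 0 < α * lam / 4 := by positivity
  have hαlam1 : α * lam / 4 ≤ 1 := by nlinarith
  have hlog := half_le_log_of_two_le hd
  have hsqrt : 1 ≤ √(d : ℝ) := Real.one_le_sqrt.2 (by exact_mod_cast one_le_two.trans hd)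
  have inv_le : 1 / lam ≤ 2 * (Real.log d / lam) := by
    rw [← mul_div_assoc]
    gcongr
    linarith
  have one_le : 1 ≤ 1 / lam := (one_le_div hlam).2 hlam1
  calc α * ∑ j ∈ Finset.range t, min 2 (√d * (1 - α * lam / 4) ^ j)
      ≤ α * (2 * (Real.log √d / (α * lam / 4) + 1) + 1 / (α * lam / 4)) := by
        gcongr
        exact sum_min_mul_one_sub_pow_le hsqrt zero_le_two hαlam hαlam1 t
    _ = 4 * (Real.log d / lam) + 2 * α + 4 * (1 / lam) := by
        rw [Real.log_sqrt (Nat.cast_nonneg d)]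
        field_simp
    _ ≤ 13 * (Real.log d / lam) := by linarith

variable {k m n : ℕ}

theorem IsControlled.maxError_gradientStep_le_add {α : ℝ} {A : Operator k m n}
    (h : IsControlled α A) :
    maxError (gradientStep α A) ≤ maxError A + 14 * α * maxError A ^ 2 := by
  have hmin := mul_le_mul_of_nonneg_left (minError_le_maxError A) h.two_mul_step_mul_size_nonneg
  linarith [h.maxError_gradientStep_le]

theorem IsControlled.step_mul_maxError_add_le {α : ℝ} {A : Operator k m n}
    (h : IsControlled α A) (hA : maxError A ≤ 1 / 28) :
    α * maxError A + maxError (gradientStep α A) ≤ maxError A + 3 / 2 * (α * minError A) := by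
  have drop_ge : 3 / 2 * α * (maxError A - minError A) ≤
      2 * α * size A * (maxError A - minError A) :=
    mul_le_mul_of_nonneg_right (by nlinarith [h.step_nonneg, h.le_size])
      (sub_nonneg.2 (minError_le_maxError A))
  have quadratic_le : 14 * α * maxError A ^ 2 ≤ 14 * α * (1 / 28 * maxError A) := by
    have hα := h.step_nonneg
    have hg := maxError_nonneg A
    rw [sq]
    gcongr
  linarith [h.maxError_gradientStep_le]

/-- `α` times the sum of the errors of the first `t` iterates of gradient descent. It bounds the
drift of the size and, up to a constant factor, the deterioration of the spectral gap. -/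
noncomputable def cumulativeError (α : ℝ) (A : Operator k m n) (t : ℕ) : ℝ :=
  α * ∑ j ∈ Finset.range t, maxError (gradientDescent α A j)

theorem gradientDescent_succ (α : ℝ) (A : Operator k m n) (t : ℕ) :
    gradientDescent α A (t + 1) = gradientStep α (gradientDescent α A t) :=
  Function.iterate_succ_apply' _ _ _

theorem cumulativeError_zero (α : ℝ) (A : Operator k m n) : cumulativeError α A 0 = 0 := by
  simp [cumulativeError]

theorem cumulativeError_succ (α : ℝ) (A : Operator k m n) (t : ℕ) :
    cumulativeError α A (t + 1) =
      cumulativeError α A t + α * maxError (gradientDescent α A t) := by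
  rw [cumulativeError, Finset.sum_range_succ, mul_add, cumulativeError]

/-- The state of gradient descent after `t` iterations: everything except the decay of the
normalized Frobenius error is measured against the cumulative error, and the last estimate bounds
the cumulative error itself through the iterations at which the smaller error is still large. -/
structure DescentState (α ε lam : ℝ) (A : Operator k m n) (t : ℕ) : Prop where
  isScaling : IsScaling A (gradientDescent α A t)
  rmsError_le : rmsError (gradientDescent α A t) ≤ ε * (1 - α * lam / 4) ^ t
  abs_size_sub_one_le : |size (gradientDescent α A t) - 1| ≤ cumulativeError α A t
  gapBound : GapBound (1 - lam / 2 + 18 * cumulativeError α A t) (gradientDescent α A t)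
  maxError_le : maxError (gradientDescent α A t) ≤ ε * (1 + 28 * cumulativeError α A t)
  cumulativeError_add_le : cumulativeError α A t + maxError (gradientDescent α A t) ≤
    ε + 3 / 2 * (ε * (α * ∑ j ∈ Finset.range t, min 2 (√(min m n : ℕ) * (1 - α * lam / 4) ^ j)))

theorem descentState_zero {α ε lam : ℝ} {A : Operator k m n} (hA : 0 < size A)
    (herr : maxError (normalize A) ≤ ε) (hgap : GapBound (1 - lam / 2) (normalize A)) :
    DescentState α ε lam A 0 where
  isScaling := isScaling_normalize hA
  rmsError_le := by simpa using! (rmsError_le_maxError _).trans herr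
  abs_size_sub_one_le := by simp [gradientDescent, size_normalize hA, cumulativeError_zero]
  gapBound := by simpa [cumulativeError_zero] using! hgap
  maxError_le := by simpa [cumulativeError_zero] using! herr
  cumulativeError_add_le := by simpa [cumulativeError_zero] using! herr

namespace DescentState

variable {α ε lam : ℝ} {A : Operator k m n} {t : ℕ}

theorem cumulativeError_nonneg (h : DescentState α ε lam A t) : 0 ≤ cumulativeError α A t :=
  (abs_nonneg _).trans h.abs_size_sub_one_le

theorem maxError_le_two_mul (h : DescentState α ε lam A t) (hε : 0 ≤ ε)
    (hD : cumulativeError α A t ≤ 1 / 28) : maxError (gradientDescent α A t) ≤ 2 * ε := by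
  have := mul_le_mul_of_nonneg_left hD hε
  linarith [h.maxError_le]

theorem isControlled (h : DescentState α ε lam A t) (hm : 0 < m) (hn : 0 < n) (hα : 0 ≤ α)
    (hα8 : α ≤ 1 / 8) (hε : 0 ≤ ε) (hε8 : ε ≤ 1 / 8) (hD : cumulativeError α A t ≤ 1 / 28) :
    IsControlled α (gradientDescent α A t) where
  step_nonneg := hα
  step_le := hα8
  left_pos := hm
  right_pos := hn
  le_size := by linarith [(abs_le.1 h.abs_size_sub_one_le).1]
  size_le := by linarith [(abs_le.1 h.abs_size_sub_one_le).2]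
  maxError_le := by linarith [h.maxError_le_two_mul hε hD]

theorem minError_le (h : DescentState α ε lam A t) (hε : 0 ≤ ε)
    (hD : cumulativeError α A t ≤ 1 / 28) :
    minError (gradientDescent α A t) ≤
      ε * min 2 (√(min m n : ℕ) * (1 - α * lam / 4) ^ t) := by
  rw [mul_min_of_nonneg _ _ hε]
  refine le_min ?_ ?_
  · exact (minError_le_maxError _).trans ((h.maxError_le_two_mul hε hD).trans_eq (mul_comm _ _))
  · rw [mul_left_comm]
    exact (minError_le_sqrt_min_mul_rmsError _).trans
      (mul_le_mul_of_nonneg_left h.rmsError_le (Real.sqrt_nonneg _))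

theorem rmsError_succ_le (h : DescentState α ε lam A t)
    (hctrl : IsControlled α (gradientDescent α A t)) (hlam : 0 ≤ lam) (hlam1 : lam ≤ 1)
    (hε : 0 ≤ ε) (hεlam : 1000 * ε ≤ lam) (hD : cumulativeError α A t ≤ lam / 64) :
    rmsError (gradientDescent α A (t + 1)) ≤ ε * (1 - α * lam / 4) ^ (t + 1) := by
  set B := gradientDescent α A t
  have hα := hctrl.step_nonneg
  have rate_le : 1 - 2 * α * (size B - (1 - lam / 2 + 18 * cumulativeError α A t)) +
      5 * α * maxError B ≤ 1 - α * lam / 4 := by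
    have gap_ge : 5 / 2 * maxError B + lam / 8 ≤
        size B - (1 - lam / 2 + 18 * cumulativeError α A t) := by
      linarith [(abs_le.1 h.abs_size_sub_one_le).1, h.maxError_le_two_mul hε (by linarith)]
    have := mul_le_mul_of_nonneg_left gap_ge hα
    linarith
  have ρ_nonneg : 0 ≤ 1 - α * lam / 4 := by nlinarith [hctrl.step_le]
  calc rmsError (gradientDescent α A (t + 1))
      ≤ (1 - α * lam / 4) * rmsError B := by
        rw [gradientDescent_succ]
        refine (hctrl.rmsError_gradientStep_le ?_ h.gapBound).trans ?_
        · linarith [h.cumulativeError_nonneg]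
        · exact mul_le_mul_of_nonneg_right rate_le (rmsError_nonneg B)
    _ ≤ (1 - α * lam / 4) * (ε * (1 - α * lam / 4) ^ t) :=
        mul_le_mul_of_nonneg_left h.rmsError_le ρ_nonneg
    _ = ε * (1 - α * lam / 4) ^ (t + 1) := by ring

theorem succ (h : DescentState α ε lam A t) (hctrl : IsControlled α (gradientDescent α A t))
    (hlam : 0 ≤ lam) (hlam1 : lam ≤ 1) (hεlam : 1000 * ε ≤ lam) (hε : 0 ≤ ε)
    (hD : cumulativeError α A t ≤ lam / 64) : DescentState α ε lam A (t + 1) := by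
  set B := gradientDescent α A t
  have hα := hctrl.step_nonneg
  have hD28 : cumulativeError α A t ≤ 1 / 28 := by linarith
  have hB0 := maxError_nonneg B
  have hB : maxError B ≤ 2 * ε := h.maxError_le_two_mul hε hD28
  have step_mul_sq_le : α * maxError B ^ 2 ≤ 2 * ε * (α * maxError B) := by
    rw [sq, mul_left_comm]
    gcongr
  refine ⟨?_, h.rmsError_succ_le hctrl hlam hlam1 hε hεlam hD, ?_, ?_, ?_, ?_⟩
  · rw [gradientDescent_succ]
    exact hctrl.isScaling_gradientStep h.isScaling
  · have drift_le : 2 * ε * (α * maxError B) ≤ 1 / 7 * (α * maxError B) := by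
      gcongr
      linarith
    rw [gradientDescent_succ, cumulativeError_succ]
    have := abs_sub_le (size (gradientStep α B)) (size B) 1
    linarith [hctrl.abs_size_gradientStep_sub_le, h.abs_size_sub_one_le]
  · rw [gradientDescent_succ, cumulativeError_succ, mul_add, ← add_assoc]
    exact hctrl.gapBound_gradientStep h.gapBound
  · rw [gradientDescent_succ, cumulativeError_succ]
    linarith [hctrl.maxError_gradientStep_le_add, h.maxError_le]
  · have hmin := mul_le_mul_of_nonneg_left (h.minError_le hε hD28) hα
    rw [gradientDescent_succ, cumulativeError_succ, Finset.sum_range_succ]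
    linarith [hctrl.step_mul_maxError_add_le (by linarith), h.cumulativeError_add_le]

end DescentState

/-- The dimensions, step size, gap and initial error for which the convergence of gradient descent
from `A` is proved. -/
structure IsAdmissible (α ε lam : ℝ) (A : Operator k m n) : Prop where
  two_le_left : 2 ≤ m
  two_le_right : 2 ≤ n
  size_pos : 0 < size A
  step_pos : 0 < α
  step_le : α ≤ 1 / 8
  gap_pos : 0 < lam
  isNearlyDoublyBalanced : IsNearlyDoublyBalanced ε A
  hasSpectralGap : HasSpectralGap lam A
  mul_log_le : 2000 * ε * Real.log (min m n : ℕ) ≤ lam ^ 2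

namespace IsAdmissible

variable {α ε lam : ℝ} {A : Operator k m n}

theorem left_pos (h : IsAdmissible α ε lam A) : 0 < m := two_pos.trans_le h.two_le_left

theorem right_pos (h : IsAdmissible α ε lam A) : 0 < n := two_pos.trans_le h.two_le_right

theorem gap_le_one (h : IsAdmissible α ε lam A) : lam ≤ 1 :=
  h.hasSpectralGap.le_one h.left_pos h.right_pos h.size_pos

theorem error_nonneg (h : IsAdmissible α ε lam A) : 0 ≤ ε :=
  h.isNearlyDoublyBalanced.nonneg h.left_pos h.size_pos

theorem mul_error_le_sq (h : IsAdmissible α ε lam A) : 1000 * ε ≤ lam ^ 2 := by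
  have hlog := half_le_log_of_two_le (le_min h.two_le_left h.two_le_right)
  nlinarith [h.mul_log_le, h.error_nonneg]

theorem mul_error_le (h : IsAdmissible α ε lam A) : 1000 * ε ≤ lam :=
  h.mul_error_le_sq.trans (pow_le_of_le_one h.gap_pos.le h.gap_le_one two_ne_zero)

theorem cumulativeError_le (h : IsAdmissible α ε lam A) {t : ℕ}
    (ht : DescentState α ε lam A t) : cumulativeError α A t ≤ lam / 64 := by
  have hd := le_min h.two_le_left h.two_le_right
  have hε := h.error_nonneg
  have hlam := h.gap_pos
  have log_div_le : ε * (Real.log (min m n : ℕ) / lam) ≤ lam / 2000 := by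
    rw [← mul_div_assoc, div_le_iff₀ hlam]
    linarith [h.mul_log_le]
  have ε_le : ε ≤ 2 * (ε * (Real.log (min m n : ℕ) / lam)) := by
    have one_le : 1 ≤ 2 * (Real.log (min m n : ℕ) / lam) := by
      rw [← mul_div_assoc, le_div_iff₀ hlam]
      linarith [half_le_log_of_two_le hd, h.gap_le_one]
    linarith [le_mul_of_one_le_right hε one_le]
  have hsum := mul_le_mul_of_nonneg_left
    (step_mul_sum_min_le h.step_pos h.step_le hlam h.gap_le_one hd t) hε
  linarith [ht.cumulativeError_add_le, maxError_nonneg (gradientDescent α A t)]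

theorem descentState (h : IsAdmissible α ε lam A) (t : ℕ) : DescentState α ε lam A t := by
  have hlam1 := h.gap_le_one
  have hε := h.error_nonneg
  induction t with
  | zero =>
    have herr := (isNearlyDoublyBalanced_iff_maxError_le A h.left_pos h.right_pos hε).1
      h.isNearlyDoublyBalanced
    exact descentState_zero h.size_pos (maxError_normalize_le h.size_pos herr)
      ((h.hasSpectralGap.gapBound h.left_pos h.right_pos h.gap_pos.le hlam1 hε
        (by linarith [h.mul_error_le_sq]) herr).normalize h.size_pos)
  | succ t ih =>
    have hD := h.cumulativeError_le ih
    exact ih.succ (ih.isControlled h.left_pos h.right_pos h.step_pos.le h.step_le hε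
      (by linarith [h.mul_error_le]) (by linarith)) h.gap_pos.le hlam1 h.mul_error_le hε hD

theorem isNearlyDoublyBalanced_gradientDescent (h : IsAdmissible α ε lam A) {η : ℝ} {t : ℕ}
    (hη : 0 < η) (ht : 4 / (α * lam) * Real.log ((m + n) / η) ≤ t) :
    IsNearlyDoublyBalanced η (gradientDescent α A t) := by
  have hα := h.step_pos
  have hlam := h.gap_pos
  have hm := h.left_pos
  have hn := h.right_pos
  have state := h.descentState t
  set B := gradientDescent α A t
  have size_ge : 3 / 4 ≤ size B := by
    linarith [(abs_le.1 state.abs_size_sub_one_le).1, h.cumulativeError_le state, h.gap_le_one]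
  have pow_le : (1 - α * lam / 4) ^ t ≤ ((m + n) / η)⁻¹ :=
    one_sub_pow_le_inv_of_log_div_le (by positivity) (by nlinarith [h.step_le, h.gap_le_one])
      (by positivity) ((by field_simp : _ = 4 / (α * lam) * Real.log ((m + n) / η)).trans_le ht)
  rw [isNearlyDoublyBalanced_iff_maxError_le B hm hn hη.le]
  calc maxError B ≤ (m + n) * rmsError B := maxError_le_add_mul_rmsError B
    _ ≤ (m + n) * (ε * ((m + n) / η)⁻¹) := by
        gcongr
        exact state.rmsError_le.trans (mul_le_mul_of_nonneg_left pow_le h.error_nonneg)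
    _ = η * ε := by field_simp
    _ ≤ η * size B := by
        gcongr
        linarith [h.mul_error_le, h.gap_le_one]

end IsAdmissible

theorem one_le_log_add_div {η : ℝ} (hm : 2 ≤ m) (hn : 2 ≤ n) (hη : 0 < η) (hη1 : η ≤ 1) :
    1 ≤ Real.log ((m + n) / η) := by
  have hm' : (2 : ℝ) ≤ m := by exact_mod_cast hm
  have hn' : (2 : ℝ) ≤ n := by exact_mod_cast hn
  rw [Real.le_log_iff_exp_le (by positivity), le_div_iff₀ hη]
  nlinarith [Real.exp_one_lt_d9, Real.exp_pos 1]

end Dynamics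

end OperatorScaling

theorem corollaryc_general :
    ∃ C c K : ℝ, 0 < C ∧ 0 < c ∧ 0 < K ∧
      ∀ (k m n : ℕ) (A : OperatorScaling.Operator k m n) (ε lam α : ℝ),
        2 ≤ m → 2 ≤ n →
        0 < OperatorScaling.size A →
        0 < lam →
        OperatorScaling.IsNearlyDoublyBalanced ε A →
        OperatorScaling.HasSpectralGap lam A →
        C * ε * Real.log (min m n : ℕ) ≤ lam ^ 2 →
        0 < α → α ≤ c →
        ∀ η : ℝ, 0 < η → η ≤ 1 →
          ∃ T : ℕ,
            (T : ℝ) ≤ K / (α * lam) * Real.log (((m : ℝ) + n) / η) ∧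
            ∀ t : ℕ, T ≤ t →
              OperatorScaling.IsScaling A (OperatorScaling.gradientDescent α A t) ∧
              OperatorScaling.IsNearlyDoublyBalanced η
                (OperatorScaling.gradientDescent α A t) := by
  refine ⟨2000, 1 / 8, 5, by norm_num, by norm_num, by norm_num, ?_⟩
  intro k m n A ε lam α hm hn hs hlam hA hgap hε hα hα8 η hη hη1
  have h : OperatorScaling.IsAdmissible α ε lam A := ⟨hm, hn, hs, hα, hα8, hlam, hA, hgap, hε⟩
  have hlog := OperatorScaling.one_le_log_add_div hm hn hη hη1
  set ℓ := Real.log (((m : ℝ) + n) / η)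
  have one_le : 1 ≤ 1 / (α * lam) * ℓ :=
    one_le_mul_of_one_le_of_one_le
      ((one_le_div (by positivity)).2 (by nlinarith [h.gap_le_one])) hlog
  refine ⟨⌈4 / (α * lam) * ℓ⌉₊, ?_, fun t ht => ⟨(h.descentState t).isScaling,
    h.isNearlyDoublyBalanced_gradientDescent hη (Nat.ceil_le.1 ht)⟩⟩
  calc (⌈4 / (α * lam) * ℓ⌉₊ : ℝ) ≤ 4 / (α * lam) * ℓ + 1 :=
        (Nat.ceil_lt_add_one (by positivity)).le
    _ ≤ 4 / (α * lam) * ℓ + 1 / (α * lam) * ℓ := by gcongr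
    _ = 5 / (α * lam) * ℓ := by ring

theorem corollaryc :
    ∃ C c K : ℝ, 0 < C ∧ 0 < c ∧ 0 < K ∧
      ∀ (k m n : ℕ) (A : OperatorScaling.Operator k m n) (ε lam : ℝ),
        2 ≤ m → m ≤ n →
        0 < OperatorScaling.size A →
        0 < lam →
        OperatorScaling.IsNearlyDoublyBalanced ε A →
        OperatorScaling.HasSpectralGap lam A →
        C * ε * Real.log m ≤ lam ^ 2 →
        ∀ η : ℝ, 0 < η → η ≤ 1 →
          ∃ T : ℕ,
            (T : ℝ) ≤ K * (((n : ℝ) + m) ^ 2 / lam) * Real.log (((m : ℝ) + n) / η) ∧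
            ∀ t : ℕ, T ≤ t →
              OperatorScaling.IsScaling A
                (OperatorScaling.gradientDescent (c / ((m : ℝ) + n) ^ 2) A t) ∧
              OperatorScaling.IsNearlyDoublyBalanced η
                (OperatorScaling.gradientDescent (c / ((m : ℝ) + n) ^ 2) A t) := by
  obtain ⟨C, c, K, hC, hc, hK, h⟩ := corollaryc_general
  refine ⟨C, c, K / c, hC, hc, div_pos hK hc, ?_⟩
  intro k m n A ε lam hm hmn hs hlam hA hgap hε η hη hη1
  have one_le : 1 ≤ ((m : ℝ) + n) ^ 2 := by
    exact_mod_cast Nat.one_le_pow _ _ (by omega)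
  obtain ⟨T, hT, hconv⟩ := h k m n A ε lam (c / ((m : ℝ) + n) ^ 2) hm (hm.trans hmn) hs hlam hA hgap
    (by rwa [min_eq_left hmn]) (by positivity) (div_le_self hc.le one_le) η hη hη1
  refine ⟨T, hT.trans_eq ?_, hconv⟩
  rw [add_comm (n : ℝ)]
  field_simp
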